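/- **Setting.** Let $x_1,\dots,x_n\in[0,1]^D$ ($n\ge 1$) be distinct training locations and let $\mu=\sum_i m_i\delta_{x_i}$ with all $m_i>0$ be a base measure (for instance the empirical measure, $m_i=1/n$). A *node* $A$ is an axis-parallel box; $|A|=\mu(A)$. Splitting $A$, with marginal interval from $a$ to $b$ along dimension $d$, at the relative location $\ell\in[0,1]$ gives the children $A_l^{(d,\ell)}=A\cap\{x_d\le a+\ell(b-a)\}$ and $A_r^{(d,\ell)}=A\setminus A_l^{(d,\ell)}$. A node is *atomic* if it contains exactly one training location. For data $y=(y_1,\dots,y_n)$ the unbalanced Haar coefficient of a split is $$w_{d,\ell}(A)=\sqrt{\frac{|A_l|\,|A_r|}{|A|}}\left(\frac{\int_{A_l}y\,d\mu}{|A_l|}-\frac{\int_{A_r}y\,d\mu}{|A_r|}\right).$$ A *RUHWT* (random unbalanced Haar wavelet tree) is specified by finite sets $\mathcal D(A)$ of admissible dimensions, probabilities $\{\lambda_d(A):d\in\mathcal D(A)\}$ and probability distributions $B_{A,d}$ on $[0,1]$ (depending measurably on $A$), such that, whenever $A$ contains at least two training locations and $\lambda_d(A)>0$, for $B_{A,d}$-almost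 every $\ell$ both children of $A$ contain a training location. The random tree $T$ is grown from the root $\Omega=[0,1]^D$: independently, every non-atomic node $A$ draws a dimension $D(A)=d$ with probability $\lambda_d(A)$, then a location $\ell\sim B_{A,d}$, and is split at $(d,\ell)$; atomic nodes are leaves. **Theorem.** Let $T$ have a RUHWT prior with parameters $\lambda_d(A),B_{A,d}$. Suppose that, given $T$ and hyperparameters $\phi$, the coefficients $w_i$ and latent variables $z_i$ at the internal nodes $A_i$ of $T$ satisfy $$(w_i,z_i)\overset{\mathrm{ind}}{\sim}p_{A_i}(w,z\mid\phi),$$ where $p_A(w,z\mid\phi)$ is a probability density with respect to $dw\,dz$, jointly measurable in $(A,w,z)$ ($dw$ is Lebesgue measure on $\mathbb R$ and $dz$ is a fixed $\sigma$-finite measure), and that, given $T$, the scaling coefficient $|\Omega|^{-1/2}\int_\Omega y\,d\mu$ is independent of the pairs $(w_i,z_i)$ and has a law not depending on $T$. Put $$M_{d,\ell}(A)=\int p_A\bigl(w_{d,\ell}(A),z\mid\phi\bigr)\,dz .$$ For every $y$ there is a function $\Phi$ with values in $[0,\infty]$, unique on the nodes that contain a training location, such that $\Phi(A)=1$ when $A$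 is atomic and $$\Phi(A)=\sum_{d\in\mathcal D(A)}\lambda_d(A)\int_0^1M_{d,\ell}(A)\,\Phi\bigl(A_l^{(d,\ell)}\bigr)\,\Phi\bigl(A_r^{(d,\ell)}\bigr)\,dB_{A,d}(\ell)$$ when $A$ contains at least two training locations. The posterior (regular conditional distribution) of $T$ given $y$, marginal over the $z_i$, exists. For almost every $y$ with respect to its marginal law, $0<\Phi(\Omega)<\infty$ and the posterior of $T$ given $y$ is again a RUHWT, with the same sets $\mathcal D(A)$, with split dimension probabilities $$P(D(A)=d\mid y)\propto\lambda_d(A)\int_0^1M_{d,\ell}(A)\,\Phi\bigl(A_l^{(d,\ell)}\bigr)\,\Phi\bigl(A_r^{(d,\ell)}\bigr)\,dB_{A,d}(\ell)$$ and, for every $d$ of positive posterior probability at $A$, split location distributions $$dB_{A,d}(\ell\mid D(A)=d,y)\propto M_{d,\ell}(A)\,\Phi\bigl(A_l^{(d,\ell)}\bigr)\,\Phi\bigl(A_r^{(d,\ell)}\bigr)\,dB_{A,d}(\ell),$$ at every node $A$ with at least two training locations where $0<\Phi(A)<\infty$ (at the remaining such nodes, which the posterior tree almost surely does not contain, any admissible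 parameters may be taken). -/

import Mathlib

open MeasureTheory ProbabilityTheory Set
open scoped ENNReal unitInterval

/-- A node: an axis-aligned box of `ℝ^D`. Along dimension `d` its marginal interval has endpoints
`a = (A d).1` and `b = (A d).2.1`; it is `[a, b]` if the flag `(A d).2.2` is `true` and `(a, b]` if
the flag is `false`. -/
abbrev Node (D : ℕ) : Type := Fin D → ℝ × ℝ × Bool

namespace Node

variable {D : ℕ}

/-- The set of points of the box `A`. -/
def cell (A : Node D) : Set (Fin D → ℝ) :=
  {x | ∀ d, (A d).1 ≤ x d ∧ ((A d).2.2 = false → (A d).1 < x d) ∧ x d ≤ (A d).2.1}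

/-- The unit cube `[0,1]^D`. -/
def root : Node D := fun _ => (0, 1, true)

/-- The point of the marginal interval `[a, b]` of `A` along `d` at relative location `ℓ ∈ [0,1]`. -/
def cut (A : Node D) (d : Fin D) (ℓ : I) : ℝ :=
  (A d).1 + (ℓ : ℝ) * ((A d).2.1 - (A d).1)

/-- The left child `A ∩ {x_d ≤ cut}`. -/
def left (A : Node D) (d : Fin D) (ℓ : I) : Node D :=
  Function.update A d ((A d).1, A.cut d ℓ, (A d).2.2)

/-- The right child `A ∩ {x_d > cut}`. -/
def right (A : Node D) (d : Fin D) (ℓ : I) : Node D :=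
  Function.update A d (A.cut d ℓ, (A d).2.1, false)

open Classical in
/-- The training locations (their indices) that lie in the node `A`. -/
noncomputable def pts {n : ℕ} (x : Fin n → Fin D → ℝ) (A : Node D) : Finset (Fin n) :=
  Finset.univ.filter fun i => x i ∈ A.cell

/-- A node is atomic if it contains exactly one training location. -/
def IsAtomic {n : ℕ} (x : Fin n → Fin D → ℝ) (A : Node D) : Prop := (A.pts x).card = 1

/-- A node that can be split: it contains at least two training locations. -/
def IsSplittable {n : ℕ} (x : Fin n → Fin D → ℝ) (A : Node D) : Prop := 2 ≤ (A.pts x).card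

end Node

/-- Finite binary trees; each internal node carries its split dimension and split location. -/
inductive SplitTree (D : ℕ) : Type
  | leaf : SplitTree D
  | node (d : Fin D) (ℓ : I) (l r : SplitTree D) : SplitTree D

namespace SplitTree

variable {D : ℕ}

/-- The split carried at the position `a` of the tree (`false` = left, `true` = right), if any. -/
def label : SplitTree D → List Bool → Unit ⊕ (Fin D × I)
  | leaf, _ => Sum.inl ()
  | node d ℓ _ _, [] => Sum.inr (d, ℓ)
  | node _ _ l _, false :: a => l.label a
  | node _ _ _ r, true :: a => r.label a

/-- The σ-algebra on trees generated by the split labels at all positions. -/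
instance instMeasurableSpace : MeasurableSpace (SplitTree D) :=
  MeasurableSpace.comap label inferInstance

/-- The internal nodes of a tree. -/
def Internal : SplitTree D → Type
  | leaf => Empty
  | node _ _ l r => Unit ⊕ (Internal l ⊕ Internal r)

/-- A tree has finitely many internal nodes. -/
instance instFintypeInternal : (t : SplitTree D) → Fintype t.Internal
  | leaf => inferInstanceAs (Fintype Empty)
  | node _ _ l r =>
    letI := instFintypeInternal l
    letI := instFintypeInternal r
    inferInstanceAs (Fintype (Unit ⊕ (Internal l ⊕ Internal r)))

/-- The position of an internal node in the tree. -/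
def addr : (t : SplitTree D) → t.Internal → List Bool
  | leaf, a => nomatch (show Empty from a)
  | node _ _ _ _, Sum.inl _ => []
  | node _ _ l _, Sum.inr (Sum.inl a) => false :: l.addr a
  | node _ _ _ r, Sum.inr (Sum.inr a) => true :: r.addr a

/-- The split `(A, d, ℓ)` at an internal node, when the root of the tree is the box given. -/
def split : (t : SplitTree D) → Node D → t.Internal → Node D × Fin D × I
  | leaf, _, a => nomatch (show Empty from a)
  | node d ℓ _ _, A, Sum.inl _ => (A, d, ℓ)
  | node d ℓ l _, A, Sum.inr (Sum.inl a) => l.split (A.left d ℓ) a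
  | node d ℓ _ r, A, Sum.inr (Sum.inr a) => r.split (A.right d ℓ) a

end SplitTree

/-- The parameters of a random unbalanced Haar wavelet tree on the training locations `x`. -/
structure RUHWT {D n : ℕ} (x : Fin n → Fin D → ℝ) where
  /-- the admissible split dimensions of a node -/
  dims : Node D → Finset (Fin D)
  /-- the split dimension probabilities -/
  weight : Node D → Fin D → ℝ≥0∞
  /-- the split location distributions on `[0,1]` -/
  loc : Kernel (Node D × Fin D) I
  measurable_weight : ∀ d, Measurable fun A => weight A d
  weight_eq_zero : ∀ A d, d ∉ dims A → weight A d = 0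
  sum_weight : ∀ A : Node D, A.IsSplittable x → ∑ d ∈ dims A, weight A d = 1
  isMarkovKernel_loc : IsMarkovKernel loc
  /-- no child without training locations is ever created -/
  children_nonempty : ∀ A : Node D, A.IsSplittable x → ∀ d ∈ dims A, weight A d ≠ 0 →
    ∀ᵐ ℓ ∂loc (A, d), ((A.left d ℓ).pts x).Nonempty ∧ ((A.right d ℓ).pts x).Nonempty

namespace RUHWT

variable {D n : ℕ} {x : Fin n → Fin D → ℝ}

open Classical in
/-- The law of the random tree grown from the node `A`, run for at most `k` generations: a node
with at least two training locations draws its split dimension and its split location, and then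
its two subtrees are grown independently; any other node is a leaf. -/
noncomputable def treeLaw (Q : RUHWT x) : ℕ → Node D → Measure (SplitTree D)
  | 0, _ => Measure.dirac SplitTree.leaf
  | k + 1, A =>
    if A.IsSplittable x then
      ∑ d ∈ Q.dims A, Q.weight A d • (Q.loc (A, d)).bind fun ℓ =>
        ((Q.treeLaw k (A.left d ℓ)).prod (Q.treeLaw k (A.right d ℓ))).map
          fun t => SplitTree.node d ℓ t.1 t.2
    else Measure.dirac SplitTree.leaf

/-- The RUHWT law on trees, grown from the unit cube. Almost surely every split strictly lowers the
number of training locations, so `n` generations always suffice for all leaves to be atomic. -/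
noncomputable def law (Q : RUHWT x) : Measure (SplitTree D) := Q.treeLaw n Node.root

/-- The factor `M_{d,ℓ}(A) Φ(A_l) Φ(A_r)`. -/
noncomputable def factor (M : Node D → Fin D → I → ℝ≥0∞) (Φ : Node D → ℝ≥0∞)
    (A : Node D) (d : Fin D) (ℓ : I) : ℝ≥0∞ :=
  M A d ℓ * Φ (A.left d ℓ) * Φ (A.right d ℓ)

/-- `Φ` solves the bottom-up recursion with local factors `M`. Nodes without training locations
never occur, and nothing is required there. -/
def IsPhi (Q : RUHWT x) (M : Node D → Fin D → I → ℝ≥0∞) (Φ : Node D → ℝ≥0∞) : Prop :=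
  (∀ A : Node D, A.IsAtomic x → Φ A = 1) ∧
  ∀ A : Node D, A.IsSplittable x →
    Φ A = ∑ d ∈ Q.dims A, Q.weight A d * ∫⁻ ℓ, factor M Φ A d ℓ ∂Q.loc (A, d)

/-- `Q'` is obtained from `Q` by reweighting with the factors `M_{d,ℓ}(A) Φ(A_l) Φ(A_r)`: at every
node where this can be normalised, the split dimension probabilities of `Q'` are
`λ_d(A) ∫ M Φ Φ dB_{A,d}` divided by their sum over `d`, and for each dimension of positive
probability the split location distribution is `M Φ Φ dB_{A,d}` divided by its total mass. -/
def IsReweighting (Q : RUHWT x) (M : Node D → Fin D → I → ℝ≥0∞) (Φ : Node D → ℝ≥0∞)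
    (Q' : RUHWT x) : Prop :=
  Q'.dims = Q.dims ∧
  ∀ A : Node D, A.IsSplittable x →
    (∑ d ∈ Q.dims A, Q.weight A d * ∫⁻ ℓ, factor M Φ A d ℓ ∂Q.loc (A, d)) ≠ 0 →
    (∑ d ∈ Q.dims A, Q.weight A d * ∫⁻ ℓ, factor M Φ A d ℓ ∂Q.loc (A, d)) ≠ ∞ →
    ∀ d ∈ Q.dims A,
      Q'.weight A d = Q.weight A d * (∫⁻ ℓ, factor M Φ A d ℓ ∂Q.loc (A, d)) /
        ∑ d' ∈ Q.dims A, Q.weight A d' * ∫⁻ ℓ, factor M Φ A d' ℓ ∂Q.loc (A, d') ∧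
      (Q'.weight A d ≠ 0 →
        Q'.loc (A, d) = (∫⁻ ℓ, factor M Φ A d ℓ ∂Q.loc (A, d))⁻¹ •
          (Q.loc (A, d)).withDensity fun ℓ => factor M Φ A d ℓ)

end RUHWT

section Haar

variable {D n : ℕ}

/-- The measure of a node under the base measure `μ = ∑ i, m i • δ_{x i}`. -/
noncomputable def nodeMass (x : Fin n → Fin D → ℝ) (m : Fin n → ℝ) (A : Node D) : ℝ :=
  ∑ i ∈ A.pts x, m i

/-- The integral `∫_A y dμ` for the base measure `μ = ∑ i, m i • δ_{x i}`. -/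
noncomputable def nodeIntegral (x : Fin n → Fin D → ℝ) (m y : Fin n → ℝ) (A : Node D) : ℝ :=
  ∑ i ∈ A.pts x, m i * y i

/-- The unbalanced Haar coefficient `w_{d,ℓ}(A) = ⟨ψ_{A,d,ℓ}, y⟩_{L²(μ)}`. -/
noncomputable def haarCoef (x : Fin n → Fin D → ℝ) (m y : Fin n → ℝ)
    (s : Node D × Fin D × I) : ℝ :=
  √(nodeMass x m (s.1.left s.2.1 s.2.2) * nodeMass x m (s.1.right s.2.1 s.2.2) / nodeMass x m s.1) *
    (nodeIntegral x m y (s.1.left s.2.1 s.2.2) / nodeMass x m (s.1.left s.2.1 s.2.2) -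
      nodeIntegral x m y (s.1.right s.2.1 s.2.2) / nodeMass x m (s.1.right s.2.1 s.2.2))

/-- The scaling coefficient `⟨1_Ω / |Ω|^{1/2}, y⟩_{L²(μ)}`, i.e. the overall mean of `y` up to a
constant; together with the coefficients of a fully grown tree it determines `y`. -/
noncomputable def scalingCoef (x : Fin n → Fin D → ℝ) (m y : Fin n → ℝ) : ℝ :=
  nodeIntegral x m y Node.root / √(nodeMass x m Node.root)

variable {Z : Type*} [MeasurableSpace Z]

/-- Given the tree `t`, the data `(y, z)` with law `η` follow the coefficient model: the pairs
`(w_i, z_i)` at the internal nodes `A_i` of `t` are independent with densities `p A_i` with respect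
to `dw dν(z)`, and they are independent of the scaling coefficient of `y`, which has law `γ`. -/
def IsCoefficientModel (x : Fin n → Fin D → ℝ) (m : Fin n → ℝ) (ν : Measure Z)
    (p : Node D → ℝ → Z → ℝ≥0∞) (γ : Measure ℝ) (t : SplitTree D)
    (η : Measure ((Fin n → ℝ) × (List Bool → Z))) : Prop :=
  η.map (fun yz => (scalingCoef x m yz.1,
      fun a : t.Internal => (haarCoef x m yz.1 (t.split Node.root a), yz.2 (t.addr a)))) =
    γ.prod (Measure.pi fun a : t.Internal =>
      (volume.prod ν).withDensity fun wz => p (t.split Node.root a).1 wz.1 wz.2)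

/-- The marginal likelihood contribution `M_{d,ℓ}(A) = ∫ p_A(w_{d,ℓ}(A), z) dz`. -/
noncomputable def marginalLik (x : Fin n → Fin D → ℝ) (m : Fin n → ℝ) (ν : Measure Z)
    (p : Node D → ℝ → Z → ℝ≥0∞) (y : Fin n → ℝ) (A : Node D) (d : Fin D) (ℓ : I) : ℝ≥0∞ :=
  ∫⁻ z, p A (haarCoef x m y (A, d, ℓ)) z ∂ν

end Haar

/-- The joint law of `(y, T)` when `T` has law `prior` and, given `T = t`, `(y, z)` has law `K t`. -/
noncomputable def jointLaw {D n : ℕ} {Z : Type*} [MeasurableSpace Z] (prior : Measure (SplitTree D))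
    (K : Kernel (SplitTree D) ((Fin n → ℝ) × (List Bool → Z))) :
    Measure ((Fin n → ℝ) × SplitTree D) :=
  (prior ⊗ₘ K).map fun q => (q.2.1, q.1)

/-!
The proof has two independent halves.

*The tree half.* Fix the data `y`. For local factors `g A d ℓ` let `SplitTree.treeProd 1 g A t` be
the product of the factors over the splits of the tree `t` grown from `A`. Since the two subtrees of
a node are independent given its split, the expectation of this product under the prior obeys the
recursion for `Φ`, and induction on the number of training locations shows that it is the only
solution (`RUHWT.isPhi_meanProd`, `RUHWT.lintegral_treeProd_eq`). The same induction shows that the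
tree law weighted by this product, divided by `Φ`, is the law of the RUHWT whose splits are
reweighted by `g A d ℓ * Φ (A.left d ℓ) * Φ (A.right d ℓ)` (`RUHWT.IsReweighting.treeLaw_eq`): the
product splits into the factor at the root and the products over the two subtrees, and the latter
are normalised by the values of `Φ` at the children.

*The data half.* Almost every tree is fully grown (`RUHWT.ae_isFull`), and along such a tree the
unbalanced Haar basis is orthonormal (`SplitTree.IsFull.parseval`). Hence the transforms along two
such trees differ by a linear isometry that fixes the scaling coefficient, and all of them carry one
and the same measure `refMeasure` to the product of the law of the scaling coefficient and Lebesgue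
measure (`map_haarTransform_refMeasure`). With respect to this common reference measure the data
have, given the tree `t`, the density `treeProd 1 M Node.root t`, where `M` are the marginal
likelihood contributions (`IsCoefficientModel.map_fst_eq`).

Bayes' formula joins the two halves (`exists_isCondKernel_withDensity`): the posterior is the prior
weighted by `treeProd 1 M Node.root`, and the normalising constant is `Φ Node.root`. Two conditional
kernels agree almost everywhere because the σ-algebra on trees is countably generated.
-/

/-! ### Geometry and measurability of nodes -/

namespace Node

variable {D n : ℕ} {x : Fin n → Fin D → ℝ}

lemma mem_pts {A : Node D} {i : Fin n} : i ∈ A.pts x ↔ x i ∈ A.cell := by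
  simp [pts]

lemma IsAtomic.nonempty {A : Node D} (h : A.IsAtomic x) : (A.pts x).Nonempty := by
  rw [← Finset.card_pos, h]; exact one_pos

lemma IsSplittable.nonempty {A : Node D} (h : A.IsSplittable x) : (A.pts x).Nonempty := by
  rw [← Finset.card_pos]; exact lt_of_lt_of_le two_pos h

lemma not_isSplittable_of_isAtomic {A : Node D} (h : A.IsAtomic x) : ¬ A.IsSplittable x := by
  unfold IsAtomic IsSplittable at *; omega

lemma isAtomic_of_not_isSplittable {A : Node D} (h : (A.pts x).Nonempty)
    (h' : ¬ A.IsSplittable x) : A.IsAtomic x := by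
  have := Finset.card_pos.2 h
  unfold IsAtomic IsSplittable at *; omega

/-- A nonempty box has ordered endpoints, so that the two children partition it. For an empty box
with `b < a` this may fail: a child can then contain points. -/
lemma mem_cell_iff_left_or_right {A : Node D} (hA : A.cell.Nonempty) (d : Fin D) (ℓ : I)
    (z : Fin D → ℝ) :
    (z ∈ (A.left d ℓ).cell ↔ z ∈ A.cell ∧ z d ≤ A.cut d ℓ) ∧
      (z ∈ (A.right d ℓ).cell ↔ z ∈ A.cell ∧ A.cut d ℓ < z d) := by
  obtain ⟨u, hu⟩ := hA
  have hab : (A d).1 ≤ (A d).2.1 := (hu d).1.trans (hu d).2.2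
  have h0 : (A d).1 ≤ A.cut d ℓ := by
    have := mul_nonneg ℓ.2.1 (sub_nonneg.2 hab)
    unfold cut; linarith
  have h1 : A.cut d ℓ ≤ (A d).2.1 := by
    have := mul_le_of_le_one_left (sub_nonneg.2 hab) ℓ.2.2
    unfold cut; linarith
  constructor
  · constructor
    · intro h
      refine ⟨fun e => ?_, ?_⟩
      · have he := h e
        by_cases hed : e = d
        · subst hed
          simp only [left, Function.update_self] at he
          exact ⟨he.1, he.2.1, he.2.2.trans h1⟩
        · simpa only [left, Function.update_of_ne hed] using he
      · have hd := h d
        simp only [left, Function.update_self] at hd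
        exact hd.2.2
    · rintro ⟨h, hc⟩ e
      have he := h e
      by_cases hed : e = d
      · subst hed
        simp only [left, Function.update_self]
        exact ⟨he.1, he.2.1, hc⟩
      · simpa only [left, Function.update_of_ne hed] using he
  · constructor
    · intro h
      have hd := h d
      simp only [right, Function.update_self] at hd
      have hlt := hd.2.1 trivial
      refine ⟨fun e => ?_, hlt⟩
      have he := h e
      by_cases hed : e = d
      · subst hed
        exact ⟨h0.trans hlt.le, fun _ => h0.trans_lt hlt, hd.2.2⟩
      · simpa only [right, Function.update_of_ne hed] using he
    · rintro ⟨h, hc⟩ e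
      have he := h e
      by_cases hed : e = d
      · subst hed
        simp only [right, Function.update_self]
        exact ⟨hc.le, fun _ => hc, he.2.2⟩
      · simpa only [right, Function.update_of_ne hed] using he

lemma cell_nonempty {A : Node D} (hA : (A.pts x).Nonempty) : A.cell.Nonempty :=
  let ⟨i, hi⟩ := hA
  ⟨x i, mem_pts.1 hi⟩

lemma disjoint_pts_children {A : Node D} (hA : (A.pts x).Nonempty) (d : Fin D) (ℓ : I) :
    Disjoint ((A.left d ℓ).pts x) ((A.right d ℓ).pts x) := by
  rw [Finset.disjoint_left]
  intro i hl hr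
  have h := mem_cell_iff_left_or_right (cell_nonempty hA) d ℓ (x i)
  exact absurd (h.1.1 (mem_pts.1 hl)).2 (not_le.2 (h.2.1 (mem_pts.1 hr)).2)

lemma pts_union_children {A : Node D} (hA : (A.pts x).Nonempty) (d : Fin D) (ℓ : I) :
    (A.left d ℓ).pts x ∪ (A.right d ℓ).pts x = A.pts x := by
  ext i
  have h := mem_cell_iff_left_or_right (cell_nonempty hA) d ℓ (x i)
  rw [Finset.mem_union, mem_pts, mem_pts, mem_pts, h.1, h.2, ← and_or_left]
  simp [le_or_gt]

lemma sum_pts_children {α : Type*} [AddCommMonoid α] {A : Node D} (hA : (A.pts x).Nonempty)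
    (d : Fin D) (ℓ : I) (f : Fin n → α) :
    ∑ i ∈ A.pts x, f i = ∑ i ∈ (A.left d ℓ).pts x, f i + ∑ i ∈ (A.right d ℓ).pts x, f i := by
  rw [← pts_union_children hA d ℓ, Finset.sum_union (disjoint_pts_children hA d ℓ)]

lemma card_pts_children {A : Node D} (hA : (A.pts x).Nonempty) (d : Fin D) (ℓ : I) :
    (A.pts x).card = ((A.left d ℓ).pts x).card + ((A.right d ℓ).pts x).card := by
  simpa only [Finset.card_eq_sum_ones] using sum_pts_children hA d ℓ (fun _ => 1)

lemma card_left_le {A : Node D} (hA : (A.pts x).Nonempty) {d : Fin D} {ℓ : I}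
    (hr : ((A.right d ℓ).pts x).Nonempty) {k : ℕ} (hk : (A.pts x).card ≤ k + 1) :
    ((A.left d ℓ).pts x).card ≤ k := by
  have := card_pts_children hA d ℓ
  have := Finset.card_pos.2 hr
  omega

lemma card_right_le {A : Node D} (hA : (A.pts x).Nonempty) {d : Fin D} {ℓ : I}
    (hl : ((A.left d ℓ).pts x).Nonempty) {k : ℕ} (hk : (A.pts x).card ≤ k + 1) :
    ((A.right d ℓ).pts x).card ≤ k := by
  have := card_pts_children hA d ℓ
  have := Finset.card_pos.2 hl
  omega

lemma pts_root (hx01 : ∀ i d, x i d ∈ Set.Icc (0 : ℝ) 1) : (root : Node D).pts x = Finset.univ := by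
  ext i
  simp only [mem_pts, Finset.mem_univ, iff_true]
  intro d
  exact ⟨(hx01 i d).1, by simp [root], (hx01 i d).2⟩

lemma card_pts_root_le : ((root : Node D).pts x).card ≤ n := by
  simpa using Finset.card_le_univ ((root : Node D).pts x)

lemma measurable_cut (d : Fin D) : Measurable fun q : Node D × I => q.1.cut d q.2 := by
  unfold cut; fun_prop

lemma measurable_left (d : Fin D) : Measurable fun q : Node D × I => q.1.left d q.2 := by
  refine measurable_pi_lambda _ fun e => ?_
  have := measurable_cut d
  by_cases h : e = d
  · subst h
    simp only [left, Function.update_self]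
    fun_prop
  · simp only [left, Function.update_of_ne h]
    fun_prop

lemma measurable_right (d : Fin D) : Measurable fun q : Node D × I => q.1.right d q.2 := by
  refine measurable_pi_lambda _ fun e => ?_
  have := measurable_cut d
  by_cases h : e = d
  · subst h
    simp only [right, Function.update_self]
    fun_prop
  · simp only [right, Function.update_of_ne h]
    fun_prop

lemma measurableSet_mem_cell (z : Fin D → ℝ) : MeasurableSet {A : Node D | z ∈ A.cell} := by
  have hset : {A : Node D | z ∈ A.cell} = ⋂ d, ({A : Node D | (A d).1 ≤ z d} ∩
      ({A : Node D | (A d).2.2 = false → (A d).1 < z d} ∩ {A : Node D | z d ≤ (A d).2.1})) := by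
    ext A
    simp [cell]
  rw [hset]
  refine MeasurableSet.iInter fun d => ?_
  have h1 : Measurable fun A : Node D => (A d).1 := by fun_prop
  have h2 : Measurable fun A : Node D => (A d).2.1 := by fun_prop
  have h3 : Measurable fun A : Node D => (A d).2.2 := by fun_prop
  refine (measurableSet_le h1 measurable_const).inter (MeasurableSet.inter ?_
    (measurableSet_le measurable_const h2))
  have h : {A : Node D | (A d).2.2 = false → (A d).1 < z d} =
      (((fun A : Node D => (A d).2.2) ⁻¹' {false})ᶜ) ∪ {A : Node D | (A d).1 < z d} := by
    ext A; simp [imp_iff_not_or]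
  rw [h]
  exact (h3 (measurableSet_singleton _)).compl.union (measurableSet_lt h1 measurable_const)

open Classical in
lemma measurable_sum_pts {α M : Type*} [MeasurableSpace α] [AddCommMonoid M] [MeasurableSpace M]
    [MeasurableAdd₂ M] (x : Fin n → Fin D → ℝ) {f : α → Fin n → M} (hf : Measurable f)
    {A : α → Node D} (hA : Measurable A) : Measurable fun a => ∑ i ∈ (A a).pts x, f a i := by
  have h : (fun a => ∑ i ∈ (A a).pts x, f a i) =
      fun a => ∑ i, if x i ∈ (A a).cell then f a i else 0 := by
    ext a; rw [pts, Finset.sum_filter]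
  rw [h]
  exact Finset.measurable_sum _ fun i _ =>
    Measurable.ite (hA (measurableSet_mem_cell (x i))) (by fun_prop) measurable_const

lemma measurable_card_pts (x : Fin n → Fin D → ℝ) :
    Measurable fun A : Node D => (A.pts x).card := by
  simpa only [Finset.card_eq_sum_ones, id] using
    measurable_sum_pts x (measurable_const (a := fun _ : Fin n => 1)) (measurable_id (α := Node D))

lemma measurableSet_isSplittable (x : Fin n → Fin D → ℝ) :
    MeasurableSet {A : Node D | A.IsSplittable x} :=
  measurable_card_pts x (.of_discrete (s := {k | 2 ≤ k}))

lemma measurableSet_isAtomic (x : Fin n → Fin D → ℝ) :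
    MeasurableSet {A : Node D | A.IsAtomic x} :=
  measurable_card_pts x (.of_discrete (s := {k | k = 1}))

end Node

/-! ### Measurability on the space of trees -/

namespace SplitTree

variable {D : ℕ}

/-- Optional split dimensions carry the discrete σ-algebra. -/
instance instMeasurableSpaceOptionFin : MeasurableSpace (Option (Fin D)) := ⊤

instance instDiscreteMeasurableSpaceOptionFin : DiscreteMeasurableSpace (Option (Fin D)) :=
  ⟨fun _ => trivial⟩

/-- The space of label families has a measurable retraction from the standard Borel space
`List Bool → Option (Fin D) × I`, so its σ-algebra is countably generated. -/
lemma countablyGenerated_labels :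
    MeasurableSpace.CountablyGenerated (List Bool → Unit ⊕ (Fin D × I)) := by
  let enc : Unit ⊕ (Fin D × I) → Option (Fin D) × I :=
    Sum.elim (fun _ => (none, 0)) (fun q => (some q.1, q.2))
  let dec : Option (Fin D) × I → Unit ⊕ (Fin D × I) := fun q =>
    match q.1 with
    | none => Sum.inl ()
    | some d => Sum.inr (d, q.2)
  have henc : Measurable enc := measurable_const.sumElim
    (((measurable_of_countable some).comp measurable_fst).prodMk measurable_snd)
  have hdec : Measurable dec := by
    refine measurable_from_prod_countable_right fun o => ?_
    cases o with
    | none => exact measurable_const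
    | some d => exact measurable_inr.comp measurable_prodMk_left
  have hde : ∀ z, dec (enc z) = z := by rintro (_ | _) <;> rfl
  have h : (MeasurableSpace.pi : MeasurableSpace (List Bool → Unit ⊕ (Fin D × I))) =
      MeasurableSpace.comap (fun f a => enc (f a)) inferInstance := by
    refine le_antisymm (fun s hs => ?_) (Measurable.comap_le (by fun_prop))
    have hs' : MeasurableSet ((fun (f : List Bool → Option (Fin D) × I) a => dec (f a)) ⁻¹' s) :=
      (measurable_pi_lambda _ fun a => hdec.comp (measurable_pi_apply a)) hs
    refine ⟨_, hs', ?_⟩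
    ext f
    simp [hde]
  rw [h]
  exact MeasurableSpace.CountablyGenerated.comap _

instance instCountablyGenerated : MeasurableSpace.CountablyGenerated (SplitTree D) :=
  letI := countablyGenerated_labels (D := D)
  MeasurableSpace.CountablyGenerated.comap label

lemma measurable_label (a : List Bool) : Measurable fun t : SplitTree D => t.label a :=
  (measurable_pi_apply a).comp (comap_measurable label)

lemma measurable_of_label {α : Type*} [MeasurableSpace α] {f : α → SplitTree D}
    (h : ∀ a, Measurable fun z => (f z).label a) : Measurable f := by
  rw [measurable_comap_iff]
  exact measurable_pi_lambda _ h

lemma measurable_node (d : Fin D) :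
    Measurable fun q : I × SplitTree D × SplitTree D => node d q.1 q.2.1 q.2.2 := by
  refine measurable_of_label fun a => ?_
  rcases a with _ | ⟨b, a⟩
  · simp only [label]
    exact measurable_inr.comp (by fun_prop)
  · cases b
    · exact (measurable_label a).comp (by fun_prop)
    · exact (measurable_label a).comp (by fun_prop)

/-- The left subtree of a tree (a leaf for a leaf). -/
def leftSub : SplitTree D → SplitTree D
  | leaf => leaf
  | node _ _ l _ => l

/-- The right subtree of a tree (a leaf for a leaf). -/
def rightSub : SplitTree D → SplitTree D
  | leaf => leaf
  | node _ _ _ r => r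

/-- The split dimension at the root of a tree, if there is one. -/
def rootDim (t : SplitTree D) : Option (Fin D) :=
  Sum.elim (fun _ => none) (fun q => some q.1) (t.label [])

/-- The split location at the root of a tree, with the value `0` for a leaf. -/
def rootLoc (t : SplitTree D) : I := Sum.elim (fun _ => 0) Prod.snd (t.label [])

lemma measurable_leftSub : Measurable (leftSub : SplitTree D → SplitTree D) :=
  measurable_of_label fun a => by
    have h : (fun t : SplitTree D => t.leftSub.label a) = fun t => t.label (false :: a) := by
      ext1 t; cases t <;> rfl
    rw [h]; exact measurable_label _

lemma measurable_rightSub : Measurable (rightSub : SplitTree D → SplitTree D) :=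
  measurable_of_label fun a => by
    have h : (fun t : SplitTree D => t.rightSub.label a) = fun t => t.label (true :: a) := by
      ext1 t; cases t <;> rfl
    rw [h]; exact measurable_label _

lemma measurable_rootDim : Measurable (rootDim : SplitTree D → Option (Fin D)) := by
  refine Measurable.comp (g := Sum.elim (fun _ => none) (fun q => some q.1)) ?_
    (measurable_label [])
  exact measurable_const.sumElim ((measurable_of_countable some).comp measurable_fst)

lemma measurable_rootLoc : Measurable (rootLoc : SplitTree D → I) :=
  (measurable_const.sumElim measurable_snd).comp (measurable_label [])

/-- The product of `h B` over the leaves `B` and of `g B d ℓ` over the splits `(B, d, ℓ)` of a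
tree whose root is the box `A`. -/
noncomputable def treeProd (h : Node D → ℝ≥0∞) (g : Node D → Fin D → I → ℝ≥0∞) :
    Node D → SplitTree D → ℝ≥0∞
  | A, leaf => h A
  | A, node d ℓ l r => g A d ℓ * treeProd h g (A.left d ℓ) l * treeProd h g (A.right d ℓ) r

/-- `treeProd`, computed from the measurable data at the root only, and set to `0` on trees with
more than `k` generations. -/
noncomputable def treeProdTrunc (h : Node D → ℝ≥0∞) (g : Node D → Fin D → I → ℝ≥0∞) :
    ℕ → Node D → SplitTree D → ℝ≥0∞
  | 0, _, _ => 0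
  | k + 1, A, t =>
    match t.rootDim with
    | none => h A
    | some d => g A d t.rootLoc * treeProdTrunc h g k (A.left d t.rootLoc) t.leftSub *
        treeProdTrunc h g k (A.right d t.rootLoc) t.rightSub

lemma eventually_treeProdTrunc_eq (h : Node D → ℝ≥0∞) (g : Node D → Fin D → I → ℝ≥0∞)
    (t : SplitTree D) (A : Node D) :
    ∀ᶠ k in Filter.atTop, treeProdTrunc h g k A t = treeProd h g A t := by
  induction t generalizing A with
  | leaf =>
    filter_upwards [Filter.eventually_ge_atTop 1] with k hk
    obtain ⟨k, rfl⟩ := Nat.exists_eq_add_of_le' hk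
    rfl
  | node d ℓ l r ihl ihr =>
    rw [← Filter.map_add_atTop_eq_nat 1, Filter.eventually_map]
    filter_upwards [ihl (A.left d ℓ), ihr (A.right d ℓ)] with k hl hr
    change g A d ℓ * treeProdTrunc h g k (A.left d ℓ) l *
        treeProdTrunc h g k (A.right d ℓ) r = _
    rw [hl, hr, treeProd]

section

variable {α : Type*} [MeasurableSpace α] {h : Node D → ℝ≥0∞}
  {g : α → Node D → Fin D → I → ℝ≥0∞}

lemma measurable_treeProdTrunc (hh : Measurable h)
    (hg : ∀ d, Measurable fun q : α × Node D × I => g q.1 q.2.1 d q.2.2) (k : ℕ) :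
    Measurable fun q : α × Node D × SplitTree D => treeProdTrunc h (g q.1) k q.2.1 q.2.2 := by
  induction k with
  | zero => exact measurable_const
  | succ k ih =>
    let F : (α × Node D × SplitTree D) × Option (Fin D) → ℝ≥0∞ := fun q =>
      match q.2 with
      | none => h q.1.2.1
      | some d => g q.1.1 q.1.2.1 d q.1.2.2.rootLoc *
          treeProdTrunc h (g q.1.1) k (q.1.2.1.left d q.1.2.2.rootLoc) q.1.2.2.leftSub *
          treeProdTrunc h (g q.1.1) k (q.1.2.1.right d q.1.2.2.rootLoc) q.1.2.2.rightSub
    have hloc : Measurable fun q : α × Node D × SplitTree D => (q.2.1, q.2.2.rootLoc) :=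
      (measurable_fst.comp measurable_snd).prodMk
        (measurable_rootLoc.comp (measurable_snd.comp measurable_snd))
    have hF : Measurable F := by
      refine measurable_from_prod_countable_left fun o => ?_
      cases o with
      | none => exact hh.comp (measurable_fst.comp measurable_snd)
      | some d =>
        refine Measurable.mul (Measurable.mul ((hg d).comp (measurable_fst.prodMk hloc)) ?_) ?_
        · exact ih.comp (measurable_fst.prodMk (((Node.measurable_left d).comp hloc).prodMk
            (measurable_leftSub.comp (measurable_snd.comp measurable_snd))))
        · exact ih.comp (measurable_fst.prodMk (((Node.measurable_right d).comp hloc).prodMk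
            (measurable_rightSub.comp (measurable_snd.comp measurable_snd))))
    exact hF.comp (measurable_id.prodMk
      (measurable_rootDim.comp (measurable_snd.comp measurable_snd)))

lemma measurable_treeProd (hh : Measurable h)
    (hg : ∀ d, Measurable fun q : α × Node D × I => g q.1 q.2.1 d q.2.2) :
    Measurable fun q : α × Node D × SplitTree D => treeProd h (g q.1) q.2.1 q.2.2 := by
  refine measurable_of_tendsto_metrizable (measurable_treeProdTrunc hh hg) ?_
  rw [tendsto_pi_nhds]
  exact fun q => tendsto_const_nhds.congr' <|
    (eventually_treeProdTrunc_eq h (g q.1) q.2.2 q.2.1).mono fun k hk => hk.symm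

lemma measurable_treeProd_of_node (hh : Measurable h)
    (hg : ∀ d, Measurable fun q : α × Node D × I => g q.1 q.2.1 d q.2.2) (A : Node D) :
    Measurable fun q : α × SplitTree D => treeProd h (g q.1) A q.2 :=
  (measurable_treeProd hh hg).comp
    (measurable_fst.prodMk (measurable_const.prodMk measurable_snd))

end

/-- A tree that is fully grown from `A`: its internal nodes can be split and its leaves are
atomic. -/
def IsFull {n : ℕ} (x : Fin n → Fin D → ℝ) : Node D → SplitTree D → Prop
  | A, leaf => A.IsAtomic x
  | A, node d ℓ l r => A.IsSplittable x ∧ IsFull x (A.left d ℓ) l ∧ IsFull x (A.right d ℓ) r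

lemma IsFull.nonempty {n : ℕ} {x : Fin n → Fin D → ℝ} {A : Node D} {t : SplitTree D}
    (h : IsFull x A t) : (A.pts x).Nonempty := by
  cases t with
  | leaf => exact Node.IsAtomic.nonempty h
  | node d ℓ l r => exact h.1.nonempty

open Classical in
lemma treeProd_indicator_eq {n : ℕ} (x : Fin n → Fin D → ℝ) (A : Node D) (t : SplitTree D) :
    treeProd (fun B => if B.IsAtomic x then 1 else 0)
        (fun B _ _ => if B.IsSplittable x then 1 else 0) A t = if IsFull x A t then 1 else 0 := by
  induction t generalizing A with
  | leaf => rfl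
  | node d ℓ l r ihl ihr =>
    rw [treeProd, ihl, ihr, IsFull]
    split_ifs <;> simp_all

/-- A product over the internal nodes of a tree splits off the root and the two subtrees. -/
lemma prod_internal_node {M : Type*} [CommMonoid M] {d : Fin D} {ℓ : I} {l r : SplitTree D}
    (F : (node d ℓ l r).Internal → M) :
    ∏ a, F a = F (Sum.inl ()) * ((∏ a : l.Internal, F (Sum.inr (Sum.inl a))) *
      ∏ a : r.Internal, F (Sum.inr (Sum.inr a))) := by
  refine (Fintype.prod_sum_type (α₁ := Unit) (α₂ := l.Internal ⊕ r.Internal) F).trans ?_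
  rw [Fintype.prod_sum_type]
  simp

lemma sum_internal_node {M : Type*} [AddCommMonoid M] {d : Fin D} {ℓ : I} {l r : SplitTree D}
    (F : (node d ℓ l r).Internal → M) :
    ∑ a, F a = F (Sum.inl ()) + ((∑ a : l.Internal, F (Sum.inr (Sum.inl a))) +
      ∑ a : r.Internal, F (Sum.inr (Sum.inr a))) := by
  refine (Fintype.sum_sum_type (α₁ := Unit) (α₂ := l.Internal ⊕ r.Internal) F).trans ?_
  rw [Fintype.sum_sum_type]
  simp

lemma treeProd_one_eq_prod (g : Node D → Fin D → I → ℝ≥0∞) (A : Node D) (t : SplitTree D) :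
    treeProd (fun _ => 1) g A t =
      ∏ a : t.Internal, g (t.split A a).1 (t.split A a).2.1 (t.split A a).2.2 := by
  induction t generalizing A with
  | leaf => exact (Fintype.prod_empty (ι := Empty) _).symm
  | node d ℓ l r ihl ihr =>
    rw [prod_internal_node, treeProd, ihl, ihr, mul_assoc]
    rfl

end SplitTree

/-! ### The law of the random tree -/

namespace RUHWT

variable {D n : ℕ} {x : Fin n → Fin D → ℝ} (Q : RUHWT x)

instance instIsMarkovKernelLoc : IsMarkovKernel Q.loc := Q.isMarkovKernel_loc

lemma sum_dims_eq_sum_univ {M : Type*} [AddCommMonoid M] (A : Node D) (F : Fin D → M)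
    (hF : ∀ d, Q.weight A d = 0 → F d = 0) : ∑ d ∈ Q.dims A, F d = ∑ d, F d :=
  Finset.sum_subset (Finset.subset_univ _) fun d _ hd => hF d (Q.weight_eq_zero A d hd)

lemma ae_children_nonempty {A : Node D} (hA : A.IsSplittable x) {d : Fin D}
    (hd : Q.weight A d ≠ 0) :
    ∀ᵐ ℓ ∂Q.loc (A, d), ((A.left d ℓ).pts x).Nonempty ∧ ((A.right d ℓ).pts x).Nonempty :=
  Q.children_nonempty A hA d (by_contra fun h => hd (Q.weight_eq_zero A d h)) hd

lemma treeLaw_succ_of_isSplittable {A : Node D} (hA : A.IsSplittable x) (k : ℕ) :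
    Q.treeLaw (k + 1) A = ∑ d ∈ Q.dims A, Q.weight A d • (Q.loc (A, d)).bind fun ℓ =>
      ((Q.treeLaw k (A.left d ℓ)).prod (Q.treeLaw k (A.right d ℓ))).map
        fun t => SplitTree.node d ℓ t.1 t.2 := by
  rw [treeLaw, if_pos hA]

lemma treeLaw_of_not_isSplittable {A : Node D} (hA : ¬ A.IsSplittable x) (k : ℕ) :
    Q.treeLaw k A = Measure.dirac SplitTree.leaf := by
  cases k with
  | zero => rfl
  | succ k => rw [treeLaw, if_neg hA]

lemma measurable_node_pair (d : Fin D) (ℓ : I) :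
    Measurable fun t : SplitTree D × SplitTree D => SplitTree.node d ℓ t.1 t.2 :=
  (SplitTree.measurable_node d).comp measurable_prodMk_left

/-- The joint law of the two subtrees at a split along `d`: both children are grown independently
by the kernel `κ`. -/
noncomputable def subtrees (κ : Kernel (Node D) (SplitTree D)) (d : Fin D) :
    Kernel (Node D × I) (SplitTree D × SplitTree D) :=
  κ.comap _ (Node.measurable_left d) ×ₖ κ.comap _ (Node.measurable_right d)

instance instIsMarkovKernelSubtrees (κ : Kernel (Node D) (SplitTree D)) [IsMarkovKernel κ]
    (d : Fin D) : IsMarkovKernel (subtrees κ d) := by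
  unfold subtrees; infer_instance

lemma subtrees_apply (κ : Kernel (Node D) (SplitTree D)) [IsMarkovKernel κ] (d : Fin D)
    (q : Node D × I) :
    subtrees κ d q = (κ (q.1.left d q.2)).prod (κ (q.1.right d q.2)) :=
  Kernel.prod_apply _ _ _

lemma measurable_map_node_subtrees (κ : Kernel (Node D) (SplitTree D)) [IsMarkovKernel κ]
    (d : Fin D) :
    Measurable fun q : Node D × I =>
      (subtrees κ d q).map fun t => SplitTree.node d q.2 t.1 t.2 := by
  refine Measure.measurable_of_measurable_coe _ fun s hs => ?_
  have hm : MeasurableSet {p : (Node D × I) × SplitTree D × SplitTree D |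
      SplitTree.node d p.1.2 p.2.1 p.2.2 ∈ s} :=
    ((SplitTree.measurable_node d).comp
      ((measurable_snd.comp measurable_fst).prodMk measurable_snd)) hs
  have h := Kernel.measurable_kernel_prodMk_left (κ := subtrees κ d) hm
  convert! h using 2 with q
  rw [Measure.map_apply (measurable_node_pair d q.2) hs]
  rfl

lemma exists_kernel_treeLaw (k : ℕ) :
    ∃ κ : Kernel (Node D) (SplitTree D), IsMarkovKernel κ ∧ ⇑κ = Q.treeLaw k := by
  classical
  induction k with
  | zero => exact ⟨Kernel.const _ (Measure.dirac SplitTree.leaf), inferInstance, rfl⟩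
  | succ k ih =>
    obtain ⟨κ, hκ, hκk⟩ := ih
    let B : Fin D → Node D → Measure (SplitTree D) := fun d A =>
      (Q.loc (A, d)).bind fun ℓ => (subtrees κ d (A, ℓ)).map fun t => SplitTree.node d ℓ t.1 t.2
    have hbr : ∀ d (A : Node D), Measurable fun ℓ : I =>
        (subtrees κ d (A, ℓ)).map fun t => SplitTree.node d ℓ t.1 t.2 := fun d A =>
      (measurable_map_node_subtrees κ d).comp measurable_prodMk_left
    have hB : ∀ d, Measurable (B d) := fun d => by
      refine Measure.measurable_of_measurable_coe _ fun s hs => ?_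
      have h : (fun A => B d A s) = fun A => ∫⁻ ℓ, ((subtrees κ d (A, ℓ)).map
          fun t => SplitTree.node d ℓ t.1 t.2) s
            ∂(Q.loc.comap (fun A => (A, d)) (by fun_prop)) A := by
        ext A
        exact Measure.bind_apply hs (hbr d A).aemeasurable
      rw [h]
      exact ((Measure.measurable_coe hs).comp
        (measurable_map_node_subtrees κ d)).lintegral_kernel_prod_right'
    have hBprob : ∀ d A, IsProbabilityMeasure (B d A) := fun d A => by
      constructor
      rw [Measure.bind_apply .univ (hbr d A).aemeasurable]
      simp [Measure.map_apply (measurable_node_pair d _) .univ]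
    have hsucc : Q.treeLaw (k + 1) = {A : Node D | A.IsSplittable x}.piecewise
        (fun A => ∑ d, Q.weight A d • B d A) (fun _ => Measure.dirac SplitTree.leaf) := by
      ext1 A
      by_cases hA : A.IsSplittable x
      · rw [Set.piecewise_eq_of_mem {A : Node D | A.IsSplittable x} _ _ hA,
          Q.treeLaw_succ_of_isSplittable hA,
          Q.sum_dims_eq_sum_univ A _ fun d hd => by rw [hd, zero_smul]]
        simp only [B, subtrees_apply, hκk]
      · rw [Set.piecewise_eq_of_notMem {A : Node D | A.IsSplittable x} _ _ hA,
          Q.treeLaw_of_not_isSplittable hA]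
    have hmeas : Measurable (Q.treeLaw (k + 1)) := by
      rw [hsucc]
      refine Measurable.piecewise (Node.measurableSet_isSplittable x) ?_ measurable_const
      refine Measure.measurable_of_measurable_coe _ fun s hs => ?_
      simp only [Measure.coe_finsetSum, Finset.sum_apply, Measure.smul_apply, smul_eq_mul]
      exact Finset.measurable_sum _ fun d _ =>
        (Q.measurable_weight d).mul ((Measure.measurable_coe hs).comp (hB d))
    refine ⟨⟨Q.treeLaw (k + 1), hmeas⟩, ⟨fun A => ?_⟩, rfl⟩
    change IsProbabilityMeasure (Q.treeLaw (k + 1) A)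
    by_cases hA : A.IsSplittable x
    · rw [hsucc, Set.piecewise_eq_of_mem {A : Node D | A.IsSplittable x} _ _ hA]
      constructor
      simp only [Measure.coe_finsetSum, Finset.sum_apply, Measure.smul_apply, smul_eq_mul,
        measure_univ, mul_one]
      rw [← Q.sum_dims_eq_sum_univ A _ fun d hd => hd, Q.sum_weight A hA]
    · rw [Q.treeLaw_of_not_isSplittable hA]
      infer_instance

lemma measurable_treeLaw (k : ℕ) : Measurable (Q.treeLaw k) := by
  obtain ⟨κ, -, hκ⟩ := Q.exists_kernel_treeLaw k
  rw [← hκ]; exact κ.measurable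

/-- `RUHWT.treeLaw` as a Markov kernel from nodes to trees. -/
noncomputable def treeKernel (k : ℕ) : Kernel (Node D) (SplitTree D) :=
  ⟨Q.treeLaw k, Q.measurable_treeLaw k⟩

instance instIsProbabilityMeasureTreeLaw (k : ℕ) (A : Node D) :
    IsProbabilityMeasure (Q.treeLaw k A) := by
  obtain ⟨κ, h, hκ⟩ := Q.exists_kernel_treeLaw k
  rw [← hκ]; infer_instance

instance instIsMarkovKernelTreeKernel (k : ℕ) : IsMarkovKernel (Q.treeKernel k) :=
  ⟨fun A => Q.instIsProbabilityMeasureTreeLaw k A⟩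

instance instIsProbabilityMeasureLaw : IsProbabilityMeasure Q.law :=
  Q.instIsProbabilityMeasureTreeLaw n Node.root

lemma measurable_lintegral_subtrees {f : SplitTree D → ℝ≥0∞} (hf : Measurable f) (k : ℕ)
    (d : Fin D) : Measurable fun q : Node D × I => ∫⁻ t, f (SplitTree.node d q.2 t.1 t.2)
      ∂(Q.treeLaw k (q.1.left d q.2)).prod (Q.treeLaw k (q.1.right d q.2)) := by
  have h : Measurable fun p : (Node D × I) × SplitTree D × SplitTree D =>
      f (SplitTree.node d p.1.2 p.2.1 p.2.2) :=
    hf.comp ((SplitTree.measurable_node d).comp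
      ((measurable_snd.comp measurable_fst).prodMk measurable_snd))
  have h' := h.lintegral_kernel_prod_right' (κ := subtrees (Q.treeKernel k) d)
  simp only [subtrees_apply] at h'
  exact h'

/-- Integration against the tree law, one generation at a time. -/
lemma lintegral_treeLaw_succ {A : Node D} (hA : A.IsSplittable x) (k : ℕ)
    {f : SplitTree D → ℝ≥0∞} (hf : Measurable f) :
    ∫⁻ t, f t ∂Q.treeLaw (k + 1) A = ∑ d ∈ Q.dims A, Q.weight A d * ∫⁻ ℓ,
      ∫⁻ t, f (SplitTree.node d ℓ t.1 t.2)
        ∂(Q.treeLaw k (A.left d ℓ)).prod (Q.treeLaw k (A.right d ℓ)) ∂Q.loc (A, d) := by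
  rw [Q.treeLaw_succ_of_isSplittable hA, lintegral_finsetSum_measure]
  refine Finset.sum_congr rfl fun d _ => ?_
  have hm : Measurable fun ℓ : I =>
      ((Q.treeLaw k (A.left d ℓ)).prod (Q.treeLaw k (A.right d ℓ))).map
        fun t => SplitTree.node d ℓ t.1 t.2 := by
    have h := (measurable_map_node_subtrees (Q.treeKernel k) d).comp
      (measurable_prodMk_left (x := A))
    simp only [Function.comp_def, subtrees_apply] at h
    exact h
  rw [lintegral_smul_measure, Measure.lintegral_bind hm.aemeasurable hf.aemeasurable, smul_eq_mul]
  congr 1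
  refine lintegral_congr fun ℓ => ?_
  rw [lintegral_map hf (measurable_node_pair d ℓ)]

lemma lintegral_treeLaw_of_not_isSplittable {A : Node D} (hA : ¬ A.IsSplittable x) (k : ℕ)
    {f : SplitTree D → ℝ≥0∞} (hf : Measurable f) :
    ∫⁻ t, f t ∂Q.treeLaw k A = f SplitTree.leaf := by
  rw [Q.treeLaw_of_not_isSplittable hA, lintegral_dirac' _ hf]

/-- The tree is fully grown after as many generations as there are training locations beyond the
first. -/
lemma treeLaw_succ_eq (k : ℕ) {A : Node D} (hA : (A.pts x).Nonempty)
    (hk : (A.pts x).card ≤ k + 1) : Q.treeLaw (k + 1) A = Q.treeLaw k A := by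
  induction k generalizing A with
  | zero =>
    have h : ¬ A.IsSplittable x := by unfold Node.IsSplittable; omega
    rw [Q.treeLaw_of_not_isSplittable h, Q.treeLaw_of_not_isSplittable h]
  | succ k ih =>
    by_cases h : A.IsSplittable x
    · refine Measure.ext_of_lintegral _ fun f hf => ?_
      rw [Q.lintegral_treeLaw_succ h _ hf, Q.lintegral_treeLaw_succ h _ hf]
      refine Finset.sum_congr rfl fun d _ => ?_
      by_cases hd : Q.weight A d = 0
      · rw [hd, zero_mul, zero_mul]
      congr 1
      refine lintegral_congr_ae ?_
      filter_upwards [Q.ae_children_nonempty h hd] with ℓ ⟨hl, hr⟩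
      rw [ih hl (Node.card_left_le hA hr hk), ih hr (Node.card_right_le hA hl hk)]
    · rw [Q.treeLaw_of_not_isSplittable h, Q.treeLaw_of_not_isSplittable h]

/-! ### The recursion for `Φ` -/

section Phi

variable {h : Node D → ℝ≥0∞} {g : Node D → Fin D → I → ℝ≥0∞}

lemma measurable_treeProd_apply (hh : Measurable h)
    (hg : ∀ d, Measurable fun q : Node D × I => g q.1 d q.2) (A : Node D) :
    Measurable (SplitTree.treeProd h g A) :=
  (SplitTree.measurable_treeProd_of_node (α := Unit) (g := fun _ => g) hh
    (fun d => (hg d).comp measurable_snd) A).comp (measurable_prodMk_left (x := ()))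

lemma lintegral_treeProd_node (hh : Measurable h)
    (hg : ∀ d, Measurable fun q : Node D × I => g q.1 d q.2) (k : ℕ) (A : Node D) (d : Fin D)
    (ℓ : I) :
    ∫⁻ t, SplitTree.treeProd h g A (SplitTree.node d ℓ t.1 t.2)
        ∂(Q.treeLaw k (A.left d ℓ)).prod (Q.treeLaw k (A.right d ℓ)) =
      g A d ℓ * (∫⁻ t, SplitTree.treeProd h g (A.left d ℓ) t ∂Q.treeLaw k (A.left d ℓ)) *
        ∫⁻ t, SplitTree.treeProd h g (A.right d ℓ) t ∂Q.treeLaw k (A.right d ℓ) := by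
  have hl := measurable_treeProd_apply hh hg (A.left d ℓ)
  have hr := measurable_treeProd_apply hh hg (A.right d ℓ)
  simp only [SplitTree.treeProd, mul_assoc]
  rw [lintegral_const_mul _ (by fun_prop),
    lintegral_prod_mul hl.aemeasurable hr.aemeasurable]

/-- Every solution of the recursion is the expected product of the local factors over the tree:
this determines `Φ` on the nodes that contain a training location. -/
lemma lintegral_treeProd_eq (hh : Measurable h) (hh1 : ∀ A : Node D, A.IsAtomic x → h A = 1)
    (hg : ∀ d, Measurable fun q : Node D × I => g q.1 d q.2) {Φ : Node D → ℝ≥0∞}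
    (hΦ : Q.IsPhi g Φ) (k : ℕ) {A : Node D} (hA : (A.pts x).Nonempty)
    (hk : (A.pts x).card ≤ k + 1) :
    ∫⁻ t, SplitTree.treeProd h g A t ∂Q.treeLaw k A = Φ A := by
  have hleaf : ∀ (k : ℕ) {A : Node D}, (A.pts x).Nonempty → ¬ A.IsSplittable x →
      ∫⁻ t, SplitTree.treeProd h g A t ∂Q.treeLaw k A = Φ A := fun k A hA hs => by
    have hat := Node.isAtomic_of_not_isSplittable hA hs
    rw [Q.lintegral_treeLaw_of_not_isSplittable hs k (measurable_treeProd_apply hh hg A),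
      SplitTree.treeProd, hh1 A hat, hΦ.1 A hat]
  induction k generalizing A with
  | zero => exact hleaf 0 hA (by unfold Node.IsSplittable; omega)
  | succ k ih =>
    by_cases hs : A.IsSplittable x
    · rw [Q.lintegral_treeLaw_succ hs k (measurable_treeProd_apply hh hg A), hΦ.2 A hs]
      refine Finset.sum_congr rfl fun d _ => ?_
      by_cases hd : Q.weight A d = 0
      · rw [hd, zero_mul, zero_mul]
      congr 1
      refine lintegral_congr_ae ?_
      filter_upwards [Q.ae_children_nonempty hs hd] with ℓ ⟨hl, hr⟩
      rw [Q.lintegral_treeProd_node hh hg, ih hl (Node.card_left_le hA hr hk),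
        ih hr (Node.card_right_le hA hl hk), factor]
    · exact hleaf (k + 1) hA hs

/-- The expected product of the local factors over the tree grown from a node. -/
noncomputable def meanProd (g : Node D → Fin D → I → ℝ≥0∞) (A : Node D) : ℝ≥0∞ :=
  ∫⁻ t, SplitTree.treeProd (fun _ => 1) g A t ∂Q.treeLaw n A

lemma isPhi_meanProd (hg : ∀ d, Measurable fun q : Node D × I => g q.1 d q.2) :
    Q.IsPhi g (Q.meanProd g) := by
  refine ⟨fun A hA => ?_, fun A hA => ?_⟩
  · rw [meanProd, Q.lintegral_treeLaw_of_not_isSplittable (Node.not_isSplittable_of_isAtomic hA) n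
      (measurable_treeProd_apply measurable_const hg A), SplitTree.treeProd]
  · have hcard : (A.pts x).card ≤ n := by simpa using Finset.card_le_univ (A.pts x)
    obtain ⟨k, hk⟩ : ∃ k, n = k + 1 :=
      Nat.exists_eq_succ_of_ne_zero (by unfold Node.IsSplittable at hA; omega)
    have hstep : ∀ B : Node D, (B.pts x).Nonempty → (B.pts x).card ≤ k → Q.meanProd g B =
        ∫⁻ t, SplitTree.treeProd (fun _ => 1) g B t ∂Q.treeLaw k B := fun B hB hBk => by
      rw [meanProd, ← Q.treeLaw_succ_eq k hB (by omega), ← hk]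
    have hn : Q.meanProd g A =
        ∫⁻ t, SplitTree.treeProd (fun _ => 1) g A t ∂Q.treeLaw (k + 1) A := by
      rw [meanProd, ← hk]
    rw [hn, Q.lintegral_treeLaw_succ hA k (measurable_treeProd_apply measurable_const hg A)]
    refine Finset.sum_congr rfl fun d _ => ?_
    by_cases hd : Q.weight A d = 0
    · rw [hd, zero_mul, zero_mul]
    congr 1
    refine lintegral_congr_ae ?_
    filter_upwards [Q.ae_children_nonempty hA hd] with ℓ ⟨hl, hr⟩
    rw [Q.lintegral_treeProd_node measurable_const hg, factor,
      hstep _ hl (Node.card_left_le hA.nonempty hr (hk ▸ hcard)),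
      hstep _ hr (Node.card_right_le hA.nonempty hl (hk ▸ hcard))]

lemma IsPhi.eq_meanProd (hg : ∀ d, Measurable fun q : Node D × I => g q.1 d q.2)
    {Φ : Node D → ℝ≥0∞} (hΦ : Q.IsPhi g Φ) {A : Node D} (hA : (A.pts x).Nonempty) :
    Φ A = Q.meanProd g A :=
  (Q.lintegral_treeProd_eq measurable_const (fun _ _ => rfl) hg hΦ n hA
    ((by simpa using Finset.card_le_univ (A.pts x) : (A.pts x).card ≤ n).trans n.le_succ)).symm

lemma measurable_meanProd {α : Type*} [MeasurableSpace α] {g : α → Node D → Fin D → I → ℝ≥0∞}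
    (hg : ∀ d, Measurable fun q : α × Node D × I => g q.1 q.2.1 d q.2.2) :
    Measurable fun q : α × Node D => Q.meanProd (g q.1) q.2 := by
  have h := SplitTree.measurable_treeProd (h := fun _ => 1) measurable_const hg
  have h' : Measurable fun p : (α × Node D) × SplitTree D =>
      SplitTree.treeProd (fun _ => 1) (g p.1.1) p.1.2 p.2 :=
    h.comp (by fun_prop : Measurable fun p : (α × Node D) × SplitTree D => (p.1.1, p.1.2, p.2))
  exact h'.lintegral_kernel_prod_right' (κ := (Q.treeKernel n).comap _ measurable_snd)

/-- Almost surely the tree is fully grown: the indicator of this event is a product over the nodes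
of the tree, and the constant `1` solves the corresponding recursion. -/
lemma ae_isFull {A : Node D} (hA : (A.pts x).Nonempty) :
    ∀ᵐ t ∂Q.treeLaw n A, SplitTree.IsFull x A t := by
  classical
  let h : Node D → ℝ≥0∞ := fun B => if B.IsAtomic x then 1 else 0
  let g : Node D → Fin D → I → ℝ≥0∞ := fun B _ _ => if B.IsSplittable x then 1 else 0
  have hh : Measurable h :=
    Measurable.ite (Node.measurableSet_isAtomic x) measurable_const measurable_const
  have hg : ∀ d, Measurable fun q : Node D × I => g q.1 d q.2 := fun d =>
    Measurable.ite (measurable_fst (Node.measurableSet_isSplittable x))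
      measurable_const measurable_const
  have hΦ : Q.IsPhi g fun _ => 1 := by
    refine ⟨fun _ _ => rfl, fun B hB => ?_⟩
    simp [factor, g, hB, Q.sum_weight B hB]
  have hint := Q.lintegral_treeProd_eq hh (fun B hB => by simp [h, hB]) hg hΦ n hA
    ((by simpa using Finset.card_le_univ (A.pts x) : (A.pts x).card ≤ n).trans n.le_succ)
  have hone : ∀ t, SplitTree.treeProd h g A t = if SplitTree.IsFull x A t then 1 else 0 :=
    SplitTree.treeProd_indicator_eq x A
  have hle : (fun t => SplitTree.treeProd h g A t) ≤ᵐ[Q.treeLaw n A] fun _ => 1 :=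
    Filter.Eventually.of_forall fun t => by
      simp only [hone]; split_ifs <;> simp
  have := ae_eq_of_ae_le_of_lintegral_le hle (by rw [hint]; exact ENNReal.one_ne_top)
    aemeasurable_const (by rw [hint]; simp)
  filter_upwards [this] with t ht
  by_contra hf
  simp [hone, hf] at ht

end Phi

end RUHWT

/-! ### Reweighting a RUHWT -/

namespace RUHWT

variable {D n : ℕ} {x : Fin n → Fin D → ℝ} (Q : RUHWT x)

/-- Reweighting a product measure factor by factor. Where the total weight `c φ₁ φ₂` vanishes, the
normalised factors `η₁`, `η₂` are irrelevant. -/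
lemma lintegral_prod_reweight {α β : Type*} [MeasurableSpace α] [MeasurableSpace β]
    {μ₁ η₁ : Measure α} {μ₂ η₂ : Measure β} [SFinite μ₁] [SFinite μ₂]
    {F₁ : α → ℝ≥0∞} {F₂ : β → ℝ≥0∞} (hF₁ : Measurable F₁) (hF₂ : Measurable F₂)
    {f : α × β → ℝ≥0∞} (hf : Measurable f) {c φ₁ φ₂ : ℝ≥0∞}
    (hφ₁ : ∫⁻ a, F₁ a ∂μ₁ = φ₁) (hφ₂ : ∫⁻ b, F₂ b ∂μ₂ = φ₂) (hc : c * φ₁ * φ₂ ≠ ∞)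
    (h₁ : φ₁ ≠ 0 → φ₁ ≠ ∞ → η₁ = φ₁⁻¹ • μ₁.withDensity F₁)
    (h₂ : φ₂ ≠ 0 → φ₂ ≠ ∞ → η₂ = φ₂⁻¹ • μ₂.withDensity F₂) :
    ∫⁻ p, f p * (c * F₁ p.1 * F₂ p.2) ∂μ₁.prod μ₂ =
      c * φ₁ * φ₂ * ∫⁻ p, f p ∂η₁.prod η₂ := by
  by_cases h0 : c * φ₁ * φ₂ = 0
  · have hG : ∫⁻ p, c * F₁ p.1 * F₂ p.2 ∂μ₁.prod μ₂ = 0 := by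
      simp only [mul_assoc] at h0 ⊢
      rw [lintegral_const_mul _ (by fun_prop),
        lintegral_prod_mul hF₁.aemeasurable hF₂.aemeasurable, hφ₁, hφ₂, h0]
    rw [h0, zero_mul]
    rw [lintegral_eq_zero_iff (by fun_prop)] at hG ⊢
    filter_upwards [hG] with p hp
    simp only [Pi.zero_apply] at hp ⊢
    rw [hp, mul_zero]
  · have hc0 : c ≠ 0 := by rintro rfl; simp at h0
    have h10 : φ₁ ≠ 0 := by rintro rfl; simp at h0
    have h20 : φ₂ ≠ 0 := by rintro rfl; simp at h0
    have h1t : φ₁ ≠ ∞ := by rintro rfl; simp [ENNReal.mul_top, ENNReal.top_mul, hc0, h20] at hc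
    have h2t : φ₂ ≠ ∞ := by rintro rfl; simp [ENNReal.mul_top, hc0, h10] at hc
    rw [h₁ h10 h1t, h₂ h20 h2t, Measure.prod_smul_left, Measure.prod_smul_right,
      prod_withDensity hF₁ hF₂, lintegral_smul_measure, lintegral_smul_measure,
      lintegral_withDensity_eq_lintegral_mul _ (by fun_prop) hf]
    have hconst : ∫⁻ p, f p * (c * F₁ p.1 * F₂ p.2) ∂μ₁.prod μ₂ =
        c * ∫⁻ p, ((fun z : α × β => F₁ z.1 * F₂ z.2) * f) p ∂μ₁.prod μ₂ := by
      rw [← lintegral_const_mul _ (by fun_prop)]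
      refine lintegral_congr fun p => ?_
      simp only [Pi.mul_apply]
      ring
    rw [hconst, smul_eq_mul, smul_eq_mul]
    set J := ∫⁻ p, ((fun z : α × β => F₁ z.1 * F₂ z.2) * f) p ∂μ₁.prod μ₂
    calc c * J = c * (φ₁ * φ₁⁻¹) * (φ₂ * φ₂⁻¹) * J := by
          rw [ENNReal.mul_inv_cancel h10 h1t, ENNReal.mul_inv_cancel h20 h2t, mul_one, mul_one]
      _ = _ := by ring

variable {g : Node D → Fin D → I → ℝ≥0∞} {Φ : Node D → ℝ≥0∞}

/-- The law of the reweighted tree is the original law, weighted by the product of the local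
factors over the tree and normalised by `Φ`. -/
lemma IsReweighting.treeLaw_eq {Q Q' : RUHWT x}
    (hg : ∀ d, Measurable fun q : Node D × I => g q.1 d q.2)
    (hΦm : Measurable Φ) (hΦ : Q.IsPhi g Φ) (hQ' : Q.IsReweighting g Φ Q') (k : ℕ) {A : Node D}
    (hA : (A.pts x).Nonempty) (hk : (A.pts x).card ≤ k + 1) (h0 : Φ A ≠ 0) (ht : Φ A ≠ ∞) :
    Q'.treeLaw k A =
      (Φ A)⁻¹ • (Q.treeLaw k A).withDensity (SplitTree.treeProd (fun _ => 1) g A) := by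
  have hleaf : ∀ (k : ℕ) {A : Node D}, (A.pts x).Nonempty → ¬ A.IsSplittable x →
      Q'.treeLaw k A =
        (Φ A)⁻¹ • (Q.treeLaw k A).withDensity (SplitTree.treeProd (fun _ => 1) g A) := by
    intro k A hA hs
    rw [Q.treeLaw_of_not_isSplittable hs, Q'.treeLaw_of_not_isSplittable hs,
      hΦ.1 A (Node.isAtomic_of_not_isSplittable hA hs),
      dirac_withDensity' (measurable_treeProd_apply measurable_const hg A), SplitTree.treeProd]
    simp
  induction k generalizing A with
  | zero => exact hleaf 0 hA (by unfold Node.IsSplittable; omega)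
  | succ k ih =>
    by_cases hs : A.IsSplittable x
    swap
    · exact hleaf (k + 1) hA hs
    have hF : Measurable (SplitTree.treeProd (fun _ => 1) g A) :=
      measurable_treeProd_apply measurable_const hg A
    refine Measure.ext_of_lintegral _ fun f hf => ?_
    rw [lintegral_smul_measure, lintegral_withDensity_eq_lintegral_mul _ hF hf,
      Q'.lintegral_treeLaw_succ hs k hf, Q.lintegral_treeLaw_succ hs k (hF.mul hf), hQ'.1,
      smul_eq_mul, Finset.mul_sum]
    have hS := hΦ.2 A hs
    refine Finset.sum_congr rfl fun d hd => ?_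
    obtain ⟨hw', hloc'⟩ := hQ'.2 A hs (hS ▸ h0) (hS ▸ ht) d hd
    rw [← hS] at hw'
    set J := ∫⁻ ℓ, factor g Φ A d ℓ ∂Q.loc (A, d) with hJ
    by_cases hw : Q.weight A d = 0
    · rw [hw', hw]; simp
    have hJt : J ≠ ∞ := fun hJt => ht <| by
      rw [hS, ENNReal.sum_eq_top]
      exact ⟨d, hd, by rw [← hJ, hJt, ENNReal.mul_top hw]⟩
    have hfac : Measurable fun ℓ => factor g Φ A d ℓ :=
      ((((hg d).comp measurable_prodMk_left).mul
        (hΦm.comp ((Node.measurable_left d).comp measurable_prodMk_left))).mul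
        (hΦm.comp ((Node.measurable_right d).comp measurable_prodMk_left)) :)
    have hG' : Measurable fun ℓ : I => ∫⁻ t, f (SplitTree.node d ℓ t.1 t.2)
        ∂(Q'.treeLaw k (A.left d ℓ)).prod (Q'.treeLaw k (A.right d ℓ)) :=
      (Q'.measurable_lintegral_subtrees hf k d).comp (measurable_prodMk_left (x := A))
    have hstep : ∫⁻ ℓ, ∫⁻ t, (SplitTree.treeProd (fun _ => 1) g A * f)
          (SplitTree.node d ℓ t.1 t.2)
          ∂(Q.treeLaw k (A.left d ℓ)).prod (Q.treeLaw k (A.right d ℓ)) ∂Q.loc (A, d) =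
        ∫⁻ ℓ, factor g Φ A d ℓ * ∫⁻ t, f (SplitTree.node d ℓ t.1 t.2)
          ∂(Q'.treeLaw k (A.left d ℓ)).prod (Q'.treeLaw k (A.right d ℓ)) ∂Q.loc (A, d) := by
      refine lintegral_congr_ae ?_
      filter_upwards [Q.ae_children_nonempty hs hw, ae_lt_top hfac hJt] with ℓ ⟨hl, hr⟩ hlt
      have hkl := Node.card_left_le hA hr hk
      have hkr := Node.card_right_le hA hl hk
      have := lintegral_prod_reweight (c := g A d ℓ)
        (measurable_treeProd_apply measurable_const hg (A.left d ℓ))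
        (measurable_treeProd_apply measurable_const hg (A.right d ℓ))
        (hf.comp (measurable_node_pair d ℓ))
        (Q.lintegral_treeProd_eq measurable_const (fun _ _ => rfl) hg hΦ k hl hkl)
        (Q.lintegral_treeProd_eq measurable_const (fun _ _ => rfl) hg hΦ k hr hkr)
        hlt.ne (ih hl hkl) (ih hr hkr)
      rw [factor, ← Function.comp_def f, ← this]
      refine lintegral_congr fun t => ?_
      simp only [Pi.mul_apply, SplitTree.treeProd, Function.comp_apply]
      rw [mul_comm]
    rw [hstep, hw']
    by_cases hJ0 : J = 0
    · have hz : ∫⁻ ℓ, factor g Φ A d ℓ * ∫⁻ t, f (SplitTree.node d ℓ t.1 t.2)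
          ∂(Q'.treeLaw k (A.left d ℓ)).prod (Q'.treeLaw k (A.right d ℓ)) ∂Q.loc (A, d) = 0 := by
        have h := (lintegral_eq_zero_iff hfac).1 (hJ ▸ hJ0)
        refine (lintegral_congr_ae (g := fun _ => 0) ?_).trans lintegral_zero
        filter_upwards [h] with ℓ hℓ
        rw [show factor g Φ A d ℓ = 0 from hℓ, zero_mul]
      rw [hz, hJ0]; simp
    · have hw'0 : Q'.weight A d ≠ 0 := by
        rw [hw', Ne, ENNReal.div_eq_zero_iff]
        simp [hw, hJ0, ht]
      rw [hloc' hw'0, lintegral_smul_measure, lintegral_withDensity_eq_lintegral_mul _ hfac hG',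
        smul_eq_mul]
      simp only [Pi.mul_apply]
      set R := ∫⁻ ℓ, factor g Φ A d ℓ * ∫⁻ t, f (SplitTree.node d ℓ t.1 t.2)
          ∂(Q'.treeLaw k (A.left d ℓ)).prod (Q'.treeLaw k (A.right d ℓ)) ∂Q.loc (A, d)
      calc Q.weight A d * J / Φ A * (J⁻¹ * R) = (J * J⁻¹) * ((Φ A)⁻¹ * (Q.weight A d * R)) := by
            rw [div_eq_mul_inv]; ring
        _ = _ := by rw [ENNReal.mul_inv_cancel hJ0 hJt, one_mul]

/-- A reweighting with respect to one solution of the recursion is one with respect to any other,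
because the factors only see nodes that contain a training location. -/
lemma IsReweighting.congr {Q Q' : RUHWT x} (hQ' : Q.IsReweighting g Φ Q') {Φ' : Node D → ℝ≥0∞}
    (h : ∀ A : Node D, (A.pts x).Nonempty → Φ A = Φ' A) : Q.IsReweighting g Φ' Q' := by
  have hfac : ∀ A : Node D, A.IsSplittable x → ∀ d, Q.weight A d ≠ 0 →
      (fun ℓ => factor g Φ A d ℓ) =ᵐ[Q.loc (A, d)] fun ℓ => factor g Φ' A d ℓ := by
    intro A hA d hd
    filter_upwards [Q.ae_children_nonempty hA hd] with ℓ ⟨hl, hr⟩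
    rw [factor, factor, h _ hl, h _ hr]
  have hmul : ∀ A : Node D, A.IsSplittable x → ∀ d,
      Q.weight A d * ∫⁻ ℓ, factor g Φ A d ℓ ∂Q.loc (A, d) =
        Q.weight A d * ∫⁻ ℓ, factor g Φ' A d ℓ ∂Q.loc (A, d) := by
    intro A hA d
    by_cases hd : Q.weight A d = 0
    · rw [hd, zero_mul, zero_mul]
    · rw [lintegral_congr_ae (hfac A hA d hd)]
  refine ⟨hQ'.1, fun A hA => ?_⟩
  have := hQ'.2 A hA
  simp only [hmul A hA] at this
  intro h0 ht d hd
  obtain ⟨hw, hloc⟩ := this h0 ht d hd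
  refine ⟨hw, fun hw' => ?_⟩
  have hd0 : Q.weight A d ≠ 0 := by
    intro hd0; rw [hw, hd0] at hw'; simp at hw'
  rw [hloc hw', lintegral_congr_ae (hfac A hA d hd0), withDensity_congr_ae (hfac A hA d hd0)]

/-- The reweighted parameters define a RUHWT; where they cannot be normalised, those of `Q` are
kept. -/
lemma exists_isReweighting (hg : ∀ d, Measurable fun q : Node D × I => g q.1 d q.2)
    (hΦm : Measurable Φ) : ∃ Q', Q.IsReweighting g Φ Q' := by
  classical
  have hfac : Measurable fun q : (Node D × Fin D) × I => factor g Φ q.1.1 q.1.2 q.2 := by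
    have h : ∀ d, Measurable fun q : Node D × I => factor g Φ q.1 d q.2 := fun d =>
      ((hg d).mul (hΦm.comp (Node.measurable_left d))).mul (hΦm.comp (Node.measurable_right d))
    have h' : Measurable fun p : (Node D × I) × Fin D => factor g Φ p.1.1 p.2 p.1.2 :=
      measurable_from_prod_countable_left h
    exact h'.comp (by fun_prop :
      Measurable fun q : (Node D × Fin D) × I => ((q.1.1, q.2), q.1.2))
  let J : Node D × Fin D → ℝ≥0∞ := fun q => ∫⁻ ℓ, factor g Φ q.1 q.2 ℓ ∂Q.loc q
  have hJ : Measurable J := hfac.lintegral_kernel_prod_right'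
  let S : Node D → ℝ≥0∞ := fun A => ∑ d, Q.weight A d * J (A, d)
  have hS : Measurable S := Finset.measurable_sum _ fun d _ =>
    (Q.measurable_weight d).mul (hJ.comp measurable_prodMk_right)
  have hSdims : ∀ A, ∑ d ∈ Q.dims A, Q.weight A d * J (A, d) = S A := fun A =>
    Q.sum_dims_eq_sum_univ A _ fun d hd => by rw [hd, zero_mul]
  let good : Set (Node D) := {A | S A ≠ 0 ∧ S A ≠ ∞}
  have hgood : MeasurableSet good :=
    (hS (measurableSet_singleton 0)).compl.inter (hS (measurableSet_singleton ∞)).compl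
  let goodJ : Set (Node D × Fin D) := {q | q.1 ∈ good ∧ J q ≠ 0 ∧ J q ≠ ∞}
  have hgoodJ : MeasurableSet goodJ := (measurable_fst hgood).inter
    ((hJ (measurableSet_singleton 0)).compl.inter (hJ (measurableSet_singleton ∞)).compl)
  let dens : Node D × Fin D → I → ℝ≥0∞ := fun q ℓ => (J q)⁻¹ * factor g Φ q.1 q.2 ℓ
  have hdens : Measurable (Function.uncurry dens) :=
    ((hJ.comp measurable_fst).inv).mul hfac
  let loc' : Kernel (Node D × Fin D) I :=
    Kernel.piecewise hgoodJ (Q.loc.withDensity dens) Q.loc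
  have hloc'good : ∀ q ∈ goodJ, loc' q =
      (J q)⁻¹ • (Q.loc q).withDensity fun ℓ => factor g Φ q.1 q.2 ℓ := fun q hq => by
    rw [Kernel.piecewise_apply, if_pos hq, Kernel.withDensity_apply _ hdens]
    exact withDensity_smul _ (hfac.comp measurable_prodMk_left)
  have hloc'bad : ∀ q ∉ goodJ, loc' q = Q.loc q := fun q hq => by
    rw [Kernel.piecewise_apply, if_neg hq]
  let weight' : Node D → Fin D → ℝ≥0∞ := fun A d =>
    if A ∈ good then Q.weight A d * J (A, d) / S A else Q.weight A d
  have hweight'0 : ∀ A d, Q.weight A d = 0 → weight' A d = 0 := fun A d hd => by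
    simp [weight', hd]
  let Q' : RUHWT x :=
    { dims := Q.dims
      weight := weight'
      loc := loc'
      measurable_weight := fun d => Measurable.ite hgood
        (((Q.measurable_weight d).mul (hJ.comp measurable_prodMk_right)).div hS)
        (Q.measurable_weight d)
      weight_eq_zero := fun A d hd => hweight'0 A d (Q.weight_eq_zero A d hd)
      sum_weight := fun A hA => by
        by_cases h : A ∈ good
        · simp only [weight', if_pos h, div_eq_mul_inv]
          rw [← Finset.sum_mul, hSdims A, ENNReal.mul_inv_cancel h.1 h.2]
        · simp only [weight', if_neg h]
          exact Q.sum_weight A hA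
      isMarkovKernel_loc := ⟨fun q => by
        by_cases hq : q ∈ goodJ
        · rw [hloc'good q hq]
          constructor
          rw [Measure.smul_apply, withDensity_apply _ .univ, setLIntegral_univ, smul_eq_mul]
          exact ENNReal.inv_mul_cancel hq.2.1 hq.2.2
        · rw [hloc'bad q hq]; infer_instance⟩
      children_nonempty := fun A hA d hd hw => by
        have h := Q.children_nonempty A hA d hd fun h => hw (hweight'0 A d h)
        by_cases hq : (A, d) ∈ goodJ
        · rw [hloc'good _ hq]
          exact Measure.ae_smul_measure (withDensity_absolutelyContinuous _ _ h) _
        · rw [hloc'bad _ hq]; exact h }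
  refine ⟨Q', rfl, fun A hA h0 ht d hd => ?_⟩
  rw [hSdims A] at h0 ht
  have hA' : A ∈ good := ⟨h0, ht⟩
  refine ⟨by rw [hSdims A]; exact if_pos hA', fun hw => ?_⟩
  have hw' : Q.weight A d * J (A, d) / S A ≠ 0 := by
    rwa [show Q'.weight A d = _ from if_pos hA'] at hw
  have hJ0 : J (A, d) ≠ 0 := by
    intro h; rw [h] at hw'; simp at hw'
  have hQ0 : Q.weight A d ≠ 0 := by
    intro h; rw [h] at hw'; simp at hw'
  have hJt : J (A, d) ≠ ∞ := fun h => ht <| by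
    rw [← hSdims A, ENNReal.sum_eq_top]
    exact ⟨d, hd, by rw [h, ENNReal.mul_top hQ0]⟩
  exact hloc'good (A, d) ⟨hA', hJ0, hJt⟩

end RUHWT

/-! ### The unbalanced Haar transform -/

section Transform

variable {D n : ℕ} {x : Fin n → Fin D → ℝ} {m : Fin n → ℝ}

lemma nodeMass_pos (hm : ∀ i, 0 < m i) {A : Node D} (hA : (A.pts x).Nonempty) :
    0 < nodeMass x m A :=
  Finset.sum_pos (fun i _ => hm i) hA

/-- The unbalanced Haar coefficient of a split, as a linear functional of the data. -/
noncomputable def haarCoefₗ (x : Fin n → Fin D → ℝ) (m : Fin n → ℝ) (s : Node D × Fin D × I) :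
    (Fin n → ℝ) →ₗ[ℝ] ℝ where
  toFun y := haarCoef x m y s
  map_add' y y' := by
    simp only [haarCoef, nodeIntegral, Pi.add_apply, mul_add, Finset.sum_add_distrib]
    ring
  map_smul' c y := by
    simp only [haarCoef, nodeIntegral, Pi.smul_apply, smul_eq_mul, mul_left_comm _ c,
      ← Finset.mul_sum, RingHom.id_apply]
    ring

/-- The scaling coefficient, as a linear functional of the data. -/
noncomputable def scalingCoefₗ (x : Fin n → Fin D → ℝ) (m : Fin n → ℝ) :
    (Fin n → ℝ) →ₗ[ℝ] ℝ where
  toFun y := scalingCoef x m y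
  map_add' y y' := by
    simp only [scalingCoef, nodeIntegral, Pi.add_apply, mul_add, Finset.sum_add_distrib]
    ring
  map_smul' c y := by
    simp only [scalingCoef, nodeIntegral, Pi.smul_apply, smul_eq_mul, mul_left_comm _ c,
      ← Finset.mul_sum, RingHom.id_apply]
    ring

lemma measurable_scalingCoef : Measurable (scalingCoef x m) := by
  unfold scalingCoef nodeIntegral; fun_prop

lemma haarCoef_const (hm : ∀ i, 0 < m i) (c : ℝ) {s : Node D × Fin D × I}
    (hl : ((s.1.left s.2.1 s.2.2).pts x).Nonempty)
    (hr : ((s.1.right s.2.1 s.2.2).pts x).Nonempty) : haarCoef x m (fun _ => c) s = 0 := by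
  have h1 := (nodeMass_pos hm hl).ne'
  have h2 := (nodeMass_pos hm hr).ne'
  have h : ∀ A : Node D, nodeIntegral x m (fun _ => c) A = nodeMass x m A * c := fun A =>
    (Finset.sum_mul _ _ _).symm
  rw [haarCoef, h, h, mul_div_cancel_left₀ _ h1, mul_div_cancel_left₀ _ h2, sub_self, mul_zero]

namespace SplitTree

/-- Along a fully grown tree the number of splits is one less than that of training locations. -/
lemma IsFull.card_internal {A : Node D} {t : SplitTree D} (h : IsFull x A t) :
    Fintype.card t.Internal + 1 = (A.pts x).card := by
  induction t generalizing A with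
  | leaf =>
    rw [show (A.pts x).card = 1 from h]
    exact congrArg (· + 1) (Fintype.card_empty)
  | node d ℓ l r ihl ihr =>
    have h1 := ihl h.2.1
    have h2 := ihr h.2.2
    have h3 := Node.card_pts_children h.1.nonempty d ℓ
    have h4 : Fintype.card (node d ℓ l r).Internal =
        1 + (Fintype.card l.Internal + Fintype.card r.Internal) := by
      simp only [Fintype.card_eq_sum_ones]
      exact sum_internal_node _
    omega

/-- At every split of a fully grown tree both children contain a training location. -/
lemma IsFull.split_children_nonempty {A : Node D} {t : SplitTree D} (h : IsFull x A t)
    (a : t.Internal) :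
    (((t.split A a).1.left (t.split A a).2.1 (t.split A a).2.2).pts x).Nonempty ∧
      (((t.split A a).1.right (t.split A a).2.1 (t.split A a).2.2).pts x).Nonempty := by
  induction t generalizing A with
  | leaf => exact nomatch (show Empty from a)
  | node d ℓ l r ihl ihr =>
    rcases a with _ | a | a
    · exact ⟨h.2.1.nonempty, h.2.2.nonempty⟩
    · exact ihl h.2.1 a
    · exact ihr h.2.2 a

/-- Parseval's identity for the unbalanced Haar basis of a fully grown tree. -/
lemma IsFull.parseval (hm : ∀ i, 0 < m i) (y : Fin n → ℝ) {A : Node D} {t : SplitTree D}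
    (h : IsFull x A t) :
    ∑ i ∈ A.pts x, m i * y i ^ 2 =
      nodeIntegral x m y A ^ 2 / nodeMass x m A +
        ∑ a : t.Internal, haarCoef x m y (t.split A a) ^ 2 := by
  induction t generalizing A with
  | leaf =>
    obtain ⟨i, hi⟩ := Finset.card_eq_one.1 (show (A.pts x).card = 1 from h)
    have hz : ∑ a : (leaf : SplitTree D).Internal,
        haarCoef x m y ((leaf : SplitTree D).split A a) ^ 2 = 0 :=
      Fintype.sum_empty (ι := Empty) _
    have := (hm i).ne'
    rw [hz, nodeIntegral, nodeMass, hi]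
    simp only [Finset.sum_singleton, add_zero]
    field_simp
  | node d ℓ l r ihl ihr =>
    have hA := h.1.nonempty
    have hL := nodeMass_pos hm h.2.1.nonempty
    have hR := nodeMass_pos hm h.2.2.nonempty
    have hmass : nodeMass x m A = nodeMass x m (A.left d ℓ) + nodeMass x m (A.right d ℓ) :=
      Node.sum_pts_children hA d ℓ m
    have hint : nodeIntegral x m y A =
        nodeIntegral x m y (A.left d ℓ) + nodeIntegral x m y (A.right d ℓ) :=
      Node.sum_pts_children hA d ℓ fun i => m i * y i
    have hroot : haarCoef x m y (A, d, ℓ) ^ 2 =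
        nodeMass x m (A.left d ℓ) * nodeMass x m (A.right d ℓ) / nodeMass x m A *
          (nodeIntegral x m y (A.left d ℓ) / nodeMass x m (A.left d ℓ) -
            nodeIntegral x m y (A.right d ℓ) / nodeMass x m (A.right d ℓ)) ^ 2 := by
      rw [haarCoef, mul_pow, Real.sq_sqrt]
      rw [hmass]; positivity
    rw [Node.sum_pts_children hA d ℓ, ihl h.2.1, ihr h.2.2, sum_internal_node]
    change _ = _ + (haarCoef x m y (A, d, ℓ) ^ 2 +
      (∑ a, haarCoef x m y (l.split (A.left d ℓ) a) ^ 2 +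
        ∑ a, haarCoef x m y (r.split (A.right d ℓ) a) ^ 2))
    rw [hroot, hint, hmass]
    generalize nodeMass x m (A.left d ℓ) = p at *
    generalize nodeMass x m (A.right d ℓ) = q at *
    have hpq : p + q ≠ 0 := by positivity
    field_simp
    ring

/-- The unbalanced Haar transform along the tree `t`: the scaling coefficient together with the
coefficients of the splits. -/
noncomputable def haarTransform (x : Fin n → Fin D → ℝ) (m : Fin n → ℝ) (t : SplitTree D)
    (y : Fin n → ℝ) : ℝ × (t.Internal → ℝ) :=
  (scalingCoef x m y, fun a => haarCoef x m y (t.split Node.root a))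

lemma measurable_haarTransform (t : SplitTree D) : Measurable (haarTransform x m t) := by
  refine measurable_scalingCoef.prodMk (measurable_pi_lambda _ fun a => ?_)
  unfold haarCoef nodeIntegral
  fun_prop

lemma IsFull.injective_haarTransform (hx01 : ∀ i d, x i d ∈ Set.Icc (0 : ℝ) 1)
    (hm : ∀ i, 0 < m i) {t : SplitTree D} (h : IsFull x Node.root t) :
    Function.Injective (haarTransform x m t) := by
  intro y y' hyy
  have h1 : scalingCoefₗ x m (y - y') = 0 := by
    rw [map_sub, sub_eq_zero]; exact congrArg Prod.fst hyy
  have h2 : ∀ a, haarCoef x m (y - y') (t.split Node.root a) = 0 := fun a => by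
    change haarCoefₗ x m (t.split Node.root a) (y - y') = 0
    rw [map_sub, sub_eq_zero]; exact congrFun (congrArg Prod.snd hyy) a
  have hpos := nodeMass_pos hm h.nonempty
  have hint : nodeIntegral x m (y - y') Node.root = 0 :=
    (div_eq_zero_iff.1 h1).resolve_right (Real.sqrt_pos.2 hpos).ne'
  have hp := h.parseval hm (y - y')
  simp only [hint, h2, Node.pts_root hx01] at hp
  have hz : ∑ i, m i * (y - y') i ^ 2 = 0 := by rw [hp]; simp
  rw [Finset.sum_eq_zero_iff_of_nonneg fun i _ => mul_nonneg (hm i).le (sq_nonneg _)] at hz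
  ext i
  have := hz i (Finset.mem_univ i)
  simpa [(hm i).ne', sub_eq_zero] using this

end SplitTree

/-- The vector with entries `√(m i)`: the image of the constant function `1` under the isometry
`y ↦ (√(m i) * y i)` from `L²(μ)` to the Euclidean space. -/
noncomputable def sqrtMass (m : Fin n → ℝ) : EuclideanSpace ℝ (Fin n) :=
  WithLp.toLp 2 fun i => √(m i)

/-- Data with scaling coefficient `q.1` whose fluctuation about the mean is given by the vector
`q.2` orthogonal to the constants. -/
noncomputable def synth (x : Fin n → Fin D → ℝ) (m : Fin n → ℝ)
    (q : ℝ × (ℝ ∙ sqrtMass m)ᗮ) : Fin n → ℝ :=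
  fun i => q.1 / √(nodeMass x m Node.root) + (q.2 : EuclideanSpace ℝ (Fin n)) i / √(m i)

lemma measurable_synth : Measurable (synth x m) := by
  unfold synth
  refine measurable_pi_lambda _ fun i => ?_
  have : Measurable fun q : ℝ × (ℝ ∙ sqrtMass m)ᗮ => (q.2 : EuclideanSpace ℝ (Fin n)) i :=
    (by fun_prop : Measurable fun v : EuclideanSpace ℝ (Fin n) => v i).comp
      (measurable_subtype_coe.comp measurable_snd)
  fun_prop

/-- A reference measure on the data: the scaling coefficient has law `γ`, and the fluctuation about
the mean is distributed by the Lebesgue measure of the orthogonal complement of the constants. -/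
noncomputable def refMeasure (x : Fin n → Fin D → ℝ) (m : Fin n → ℝ) (γ : Measure ℝ) :
    Measure (Fin n → ℝ) :=
  (γ.prod (volume : Measure (ℝ ∙ sqrtMass m)ᗮ)).map (synth x m)

instance instSFiniteRefMeasure (γ : Measure ℝ) [SFinite γ] : SFinite (refMeasure x m γ) := by
  unfold refMeasure; infer_instance

lemma sum_mul_sqrtMass_orthogonal (hm : ∀ i, 0 < m i) (v : (ℝ ∙ sqrtMass m)ᗮ) :
    ∑ i, m i * ((v : EuclideanSpace ℝ (Fin n)) i / √(m i)) = 0 := by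
  have h := Submodule.mem_orthogonal_singleton_iff_inner_right.1 v.2
  rw [PiLp.inner_apply] at h
  rw [← h]
  refine Finset.sum_congr rfl fun i _ => ?_
  have := Real.sqrt_pos.2 (hm i)
  simp only [sqrtMass, RCLike.inner_apply, conj_trivial]
  field_simp
  rw [Real.sq_sqrt (hm i).le, mul_comm]

lemma scalingCoef_synth (hx01 : ∀ i d, x i d ∈ Set.Icc (0 : ℝ) 1) (hm : ∀ i, 0 < m i)
    (hn : 1 ≤ n) (q : ℝ × (ℝ ∙ sqrtMass m)ᗮ) : scalingCoef x m (synth x m q) = q.1 := by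
  have hne : ((Node.root : Node D).pts x).Nonempty := by
    rw [Node.pts_root hx01]; exact ⟨⟨0, hn⟩, Finset.mem_univ _⟩
  have hpos := Real.sqrt_pos.2 (nodeMass_pos hm hne)
  have hint : nodeIntegral x m (synth x m q) Node.root =
      nodeMass x m Node.root * (q.1 / √(nodeMass x m Node.root)) := by
    have hmass : nodeMass x m Node.root = ∑ i, m i := by rw [nodeMass, Node.pts_root hx01]
    rw [nodeIntegral, Node.pts_root hx01]
    simp only [synth, mul_add, Finset.sum_add_distrib, sum_mul_sqrtMass_orthogonal hm, add_zero]
    rw [← Finset.sum_mul, ← hmass]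
  rw [scalingCoef, hint]
  field_simp
  rw [Real.sq_sqrt (nodeMass_pos hm hne).le, mul_comm]

/-- The Haar coefficients of the fluctuation about the mean depend on it through a linear isometry:
this is Parseval's identity without the scaling coefficient. -/
lemma exists_isometry_haarCoef (hx01 : ∀ i d, x i d ∈ Set.Icc (0 : ℝ) 1) (hm : ∀ i, 0 < m i)
    {t : SplitTree D} (h : SplitTree.IsFull x Node.root t) :
    ∃ R : (ℝ ∙ sqrtMass m)ᗮ →ₗᵢ[ℝ] EuclideanSpace ℝ t.Internal, ∀ s v a,
      R v a = haarCoef x m (synth x m (s, v)) (t.split Node.root a) := by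
  let V : (ℝ ∙ sqrtMass m)ᗮ →ₗ[ℝ] (Fin n → ℝ) :=
    { toFun := fun v i => (v : EuclideanSpace ℝ (Fin n)) i / √(m i)
      map_add' := fun v w => by ext i; simp [add_div]
      map_smul' := fun c v => by ext i; simp [mul_div_assoc] }
  let R : (ℝ ∙ sqrtMass m)ᗮ →ₗ[ℝ] EuclideanSpace ℝ t.Internal :=
    (WithLp.linearEquiv 2 ℝ (t.Internal → ℝ)).symm.toLinearMap ∘ₗ
      LinearMap.pi fun a => haarCoefₗ x m (t.split Node.root a) ∘ₗ V
  have hR : ∀ v a, R v a = haarCoef x m (V v) (t.split Node.root a) := fun v a => rfl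
  refine ⟨⟨R, fun v => ?_⟩, fun s v a => ?_⟩
  · have hp := h.parseval hm (V v)
    have hint : nodeIntegral x m (V v) Node.root = 0 := by
      rw [nodeIntegral, Node.pts_root hx01]; exact sum_mul_sqrtMass_orthogonal hm v
    rw [hint, Node.pts_root hx01] at hp
    have hnorm : ‖R v‖ ^ 2 = ‖v‖ ^ 2 := by
      rw [Submodule.coe_norm, EuclideanSpace.real_norm_sq_eq, EuclideanSpace.real_norm_sq_eq]
      simp only [hR]
      rw [zero_pow two_ne_zero, zero_div, zero_add] at hp
      rw [← hp]
      refine Finset.sum_congr rfl fun i _ => ?_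
      have := (hm i).ne'
      simp only [V, LinearMap.coe_mk, AddHom.coe_mk, div_pow, Real.sq_sqrt (hm i).le]
      field_simp
    exact (sq_eq_sq₀ (norm_nonneg _) (norm_nonneg _)).1 hnorm
  · obtain ⟨hl, hr⟩ := h.split_children_nonempty a
    have hadd : synth x m (s, v) = (fun _ => s / √(nodeMass x m Node.root)) + V v := rfl
    change R v a = haarCoefₗ x m _ (synth x m (s, v))
    rw [hadd, map_add, hR]
    change _ = haarCoef x m (fun _ => s / √(nodeMass x m Node.root)) _ + _
    rw [haarCoef_const hm _ hl hr, zero_add]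
    rfl

/-- Along every fully grown tree the Haar transform carries the reference measure to the product of
`γ` and Lebesgue measure: Lebesgue measure is invariant under linear isometries. -/
lemma map_haarTransform_refMeasure (hx01 : ∀ i d, x i d ∈ Set.Icc (0 : ℝ) 1) (hm : ∀ i, 0 < m i)
    (hn : 1 ≤ n) (γ : Measure ℝ) [SFinite γ] {t : SplitTree D}
    (h : SplitTree.IsFull x Node.root t) :
    (refMeasure x m γ).map (SplitTree.haarTransform x m t) = γ.prod volume := by
  obtain ⟨R, hR⟩ := exists_isometry_haarCoef hx01 hm h
  have hcard := h.card_internal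
  rw [Node.pts_root hx01, Finset.card_univ, Fintype.card_fin] at hcard
  have hne : sqrtMass m ≠ 0 := fun h0 => by
    have := congrArg (fun v : EuclideanSpace ℝ (Fin n) => v ⟨0, hn⟩) h0
    exact (Real.sqrt_pos.2 (hm ⟨0, hn⟩)).ne' this
  have hrank : Module.finrank ℝ (ℝ ∙ sqrtMass m)ᗮ =
      Module.finrank ℝ (EuclideanSpace ℝ t.Internal) := by
    have : Fact (Module.finrank ℝ (EuclideanSpace ℝ (Fin n)) = Fintype.card t.Internal + 1) :=
      ⟨by rw [finrank_euclideanSpace_fin, hcard]⟩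
    rw [Submodule.finrank_orthogonal_span_singleton (n := Fintype.card t.Internal) hne,
      finrank_euclideanSpace]
  have hmp : (volume : Measure (ℝ ∙ sqrtMass m)ᗮ).map
      (fun v => (R v : EuclideanSpace ℝ t.Internal).ofLp) = volume := by
    have h1 := (R.toLinearIsometryEquiv hrank).measurePreserving
    have h2 := (PiLp.volume_preserving_ofLp t.Internal).comp h1
    exact h2.map_eq
  have hRm : Measurable fun v => (R v : EuclideanSpace ℝ t.Internal).ofLp :=
    (PiLp.volume_preserving_ofLp t.Internal).measurable.comp R.continuous.measurable
  rw [refMeasure, Measure.map_map (SplitTree.measurable_haarTransform t) measurable_synth]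
  have hcomp : SplitTree.haarTransform x m t ∘ synth x m =
      Prod.map id fun v => (R v : EuclideanSpace ℝ t.Internal).ofLp := by
    ext q
    · exact scalingCoef_synth hx01 hm hn q
    · exact (hR q.1 q.2 _).symm
  rw [hcomp, ← Measure.map_prod_map _ _ measurable_id hRm, Measure.map_id, hmp]

end Transform

/-! ### The law of the data along a fixed tree -/

section Density

lemma lmarginal_prod_eq_prod_lintegral {ι : Type*} [DecidableEq ι] {X : ι → Type*}
    [∀ i, MeasurableSpace (X i)] (μ : ∀ i, Measure (X i)) [∀ i, SigmaFinite (μ i)]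
    {f : ∀ i, X i → ℝ≥0∞} (hf : ∀ i, Measurable (f i)) (s : Finset ι) :
    lmarginal μ s (fun z => ∏ i ∈ s, f i (z i)) = fun _ => ∏ i ∈ s, ∫⁻ a, f i a ∂μ i := by
  induction s using Finset.induction_on with
  | empty => simp
  | insert i s hi ih =>
    rw [lmarginal_insert' _ (by fun_prop) hi]
    have h : (fun z => ∫⁻ a, ∏ j ∈ insert i s, f j (Function.update z i a j) ∂μ i) =
        fun z : ∀ j, X j => (∫⁻ a, f i a ∂μ i) * ∏ j ∈ s, f j (z j) := by
      ext z
      rw [← lintegral_mul_const _ (hf i)]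
      refine lintegral_congr fun a => ?_
      rw [Finset.prod_insert hi, Function.update_self]
      congr 1
      refine Finset.prod_congr rfl fun j hj => ?_
      rw [Function.update_of_ne (ne_of_mem_of_not_mem hj hi)]
    rw [h]
    ext z
    rw [Finset.prod_insert hi, ← congrFun ih z]
    exact lintegral_const_mul _ ((by fun_prop :
      Measurable fun z : ∀ j, X j => ∏ j ∈ s, f j (z j)).comp measurable_updateFinset)

lemma pi_withDensity {ι : Type*} [Fintype ι] {X : ι → Type*} [∀ i, MeasurableSpace (X i)]
    [∀ i, Nonempty (X i)] (μ : ∀ i, Measure (X i)) [∀ i, SigmaFinite (μ i)]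
    {f : ∀ i, X i → ℝ≥0∞} (hf : ∀ i, Measurable (f i))
    [∀ i, SigmaFinite ((μ i).withDensity (f i))] :
    Measure.pi (fun i => (μ i).withDensity (f i)) =
      (Measure.pi μ).withDensity fun z => ∏ i, f i (z i) := by
  classical
  refine Measure.pi_eq fun s hs => ?_
  have hpi : MeasurableSet (Set.univ.pi s) := MeasurableSet.univ_pi hs
  have hind : (Set.univ.pi s).indicator (fun z => ∏ i, f i (z i)) =
      fun z => ∏ i, (s i).indicator (f i) (z i) := by
    ext z
    by_cases hz : z ∈ Set.univ.pi s
    · rw [Set.indicator_of_mem hz]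
      exact Finset.prod_congr rfl fun i _ => (Set.indicator_of_mem (hz i trivial) _).symm
    · rw [Set.indicator_of_notMem hz]
      obtain ⟨i, hi⟩ : ∃ i, z i ∉ s i := by simpa [Set.mem_pi] using hz
      exact (Finset.prod_eq_zero (Finset.mem_univ i) (Set.indicator_of_notMem hi _)).symm
  have hfm : ∀ i, Measurable ((s i).indicator (f i)) := fun i => (hf i).indicator (hs i)
  rw [withDensity_apply _ hpi, ← lintegral_indicator hpi, hind]
  have h := lmarginal_prod_eq_prod_lintegral μ hfm Finset.univ
  rw [lmarginal_univ] at h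
  rw [congrFun h fun i => Classical.arbitrary (X i)]
  refine Finset.prod_congr rfl fun i _ => ?_
  rw [withDensity_apply _ (hs i), lintegral_indicator (hs i)]

variable {D n : ℕ} {x : Fin n → Fin D → ℝ} {m : Fin n → ℝ} {Z : Type*} [MeasurableSpace Z]
  {ν : Measure Z} {p : Node D → ℝ → Z → ℝ≥0∞}

lemma measurable_haarCoef (x : Fin n → Fin D → ℝ) (m : Fin n → ℝ) (d : Fin D) :
    Measurable fun q : (Fin n → ℝ) × Node D × I => haarCoef x m q.1 (q.2.1, d, q.2.2) := by
  have hA : Measurable fun q : (Fin n → ℝ) × Node D × I => q.2.1 := by fun_prop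
  have hL : Measurable fun q : (Fin n → ℝ) × Node D × I => q.2.1.left d q.2.2 :=
    (Node.measurable_left d).comp measurable_snd
  have hR : Measurable fun q : (Fin n → ℝ) × Node D × I => q.2.1.right d q.2.2 :=
    (Node.measurable_right d).comp measurable_snd
  have hm : Measurable fun _ : (Fin n → ℝ) × Node D × I => m := measurable_const
  have hmy : Measurable fun (q : (Fin n → ℝ) × Node D × I) i => m i * q.1 i := by fun_prop
  have h1 := Node.measurable_sum_pts x hm hA
  have h2 := Node.measurable_sum_pts x hm hL
  have h3 := Node.measurable_sum_pts x hm hR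
  have h4 := Node.measurable_sum_pts x hmy hL
  have h5 := Node.measurable_sum_pts x hmy hR
  exact (((h2.mul h3).div h1).sqrt).mul ((h4.div h2).sub (h5.div h3))

lemma measurable_marginalLik [SigmaFinite ν]
    (hp : Measurable fun q : Node D × ℝ × Z => p q.1 q.2.1 q.2.2) (d : Fin D) :
    Measurable fun q : (Fin n → ℝ) × Node D × I => marginalLik x m ν p q.1 q.2.1 d q.2.2 := by
  have h : Measurable fun r : ((Fin n → ℝ) × Node D × I) × Z =>
      p r.1.2.1 (haarCoef x m r.1.1 (r.1.2.1, d, r.1.2.2)) r.2 := by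
    have hw := (measurable_haarCoef x m d).comp
      (measurable_fst : Measurable fun r : ((Fin n → ℝ) × Node D × I) × Z => r.1)
    exact hp.comp ((by fun_prop : Measurable fun r : ((Fin n → ℝ) × Node D × I) × Z =>
      r.1.2.1).prodMk (hw.prodMk measurable_snd))
  exact h.lintegral_prod_right'

lemma map_fst_withDensity [SFinite ν] {f : ℝ × Z → ℝ≥0∞} (hf : Measurable f) :
    ((volume.prod ν).withDensity f).map Prod.fst =
      (volume : Measure ℝ).withDensity fun w => ∫⁻ z, f (w, z) ∂ν := by
  ext s hs
  rw [Measure.map_apply measurable_fst hs, withDensity_apply _ (measurable_fst hs),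
    withDensity_apply _ hs, show Prod.fst ⁻¹' s = s ×ˢ (univ : Set Z) by ext; simp,
    setLIntegral_prod _ hf.aemeasurable]
  simp

/-- Along a fully grown tree the data have, with respect to the reference measure, the product of
the marginal likelihood contributions of the splits as density. -/
lemma IsCoefficientModel.map_fst_eq [SigmaFinite ν] (hx01 : ∀ i d, x i d ∈ Set.Icc (0 : ℝ) 1)
    (hm : ∀ i, 0 < m i) (hn : 1 ≤ n)
    (hp : Measurable fun q : Node D × ℝ × Z => p q.1 q.2.1 q.2.2)
    (hp1 : ∀ A, ∫⁻ w, ∫⁻ z, p A w z ∂ν = 1) {γ : Measure ℝ} [SFinite γ] {t : SplitTree D}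
    {η : Measure ((Fin n → ℝ) × (List Bool → Z))} (ht : SplitTree.IsFull x Node.root t)
    (hη : IsCoefficientModel x m ν p γ t η) :
    η.map Prod.fst = (refMeasure x m γ).withDensity fun y =>
      SplitTree.treeProd (fun _ => 1) (marginalLik x m ν p y) Node.root t := by
  have hH := SplitTree.measurable_haarTransform (x := x) (m := m) t
  have hemb : MeasurableEmbedding (SplitTree.haarTransform x m t) :=
    hH.measurableEmbedding (ht.injective_haarTransform hx01 hm)
  have hpA : ∀ A, Measurable fun wz : ℝ × Z => p A wz.1 wz.2 := fun A =>
    hp.comp measurable_prodMk_left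
  -- the density of the coefficients, with the latent variables integrated out
  let f : t.Internal → ℝ → ℝ≥0∞ := fun a w => ∫⁻ z, p (t.split Node.root a).1 w z ∂ν
  have hf : ∀ a, Measurable (f a) := fun a => (hpA _).lintegral_prod_right'
  have hF : Measurable fun v : t.Internal → ℝ => ∏ a, f a (v a) :=
    Finset.measurable_prod _ fun a _ => (hf a).comp (measurable_pi_apply a)
  have hprob : ∀ a : t.Internal, IsProbabilityMeasure
      ((volume.prod ν).withDensity fun wz : ℝ × Z => p (t.split Node.root a).1 wz.1 wz.2) :=
    fun a => ⟨by
      rw [withDensity_apply _ .univ, setLIntegral_univ, lintegral_prod _ (hpA _).aemeasurable]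
      exact hp1 _⟩
  have hmapf : ∀ a : t.Internal,
      ((volume.prod ν).withDensity fun wz : ℝ × Z => p (t.split Node.root a).1 wz.1 wz.2).map
        Prod.fst = volume.withDensity (f a) := fun a => map_fst_withDensity (hpA _)
  have hprobf : ∀ a, IsProbabilityMeasure ((volume : Measure ℝ).withDensity (f a)) := fun a => by
    rw [← hmapf a]
    exact Measure.isProbabilityMeasure_map measurable_fst.aemeasurable
  have hprobm : ∀ a : t.Internal, IsProbabilityMeasure
      (((volume.prod ν).withDensity fun wz : ℝ × Z => p (t.split Node.root a).1 wz.1 wz.2).map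
        Prod.fst) := fun a => Measure.isProbabilityMeasure_map measurable_fst.aemeasurable
  have hforget : Measurable fun (v : t.Internal → ℝ × Z) a => (v a).1 := by fun_prop
  have hbig : Measurable fun yz : (Fin n → ℝ) × (List Bool → Z) => (scalingCoef x m yz.1,
      fun a : t.Internal => (haarCoef x m yz.1 (t.split Node.root a), yz.2 (t.addr a))) := by
    refine (measurable_scalingCoef.comp measurable_fst).prodMk (measurable_pi_lambda _ fun a => ?_)
    exact ((measurable_pi_apply a).comp (measurable_snd.comp (hH.comp measurable_fst))).prodMk
      ((measurable_pi_apply _).comp measurable_snd)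
  have hmap : (η.map Prod.fst).map (SplitTree.haarTransform x m t) =
      (γ.prod volume).withDensity fun q : ℝ × (t.Internal → ℝ) => ∏ a, f a (q.2 a) := by
    rw [Measure.map_map hH measurable_fst]
    have hcomp : SplitTree.haarTransform x m t ∘ Prod.fst =
        Prod.map id (fun (v : t.Internal → ℝ × Z) a => (v a).1) ∘
          fun yz : (Fin n → ℝ) × (List Bool → Z) => (scalingCoef x m yz.1,
            fun a : t.Internal => (haarCoef x m yz.1 (t.split Node.root a), yz.2 (t.addr a))) :=
      rfl
    rw [hcomp, ← Measure.map_map (measurable_id.prodMap hforget) hbig, hη,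
      ← Measure.map_prod_map _ _ measurable_id hforget, Measure.map_id,
      Measure.pi_map_pi (hμ := fun a => inferInstance) fun a => measurable_fst.aemeasurable]
    simp only [hmapf]
    rw [pi_withDensity _ hf, prod_withDensity_right hF]
    rfl
  have hmap' : ((refMeasure x m γ).withDensity fun y =>
      SplitTree.treeProd (fun _ => 1) (marginalLik x m ν p y) Node.root t).map
        (SplitTree.haarTransform x m t) =
      (γ.prod volume).withDensity fun q : ℝ × (t.Internal → ℝ) => ∏ a, f a (q.2 a) := by
    rw [← map_haarTransform_refMeasure hx01 hm hn γ ht]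
    ext s hs
    rw [Measure.map_apply hH hs, withDensity_apply _ (hH hs), withDensity_apply _ hs,
      setLIntegral_map hs (f := fun q : ℝ × (t.Internal → ℝ) => ∏ a, f a (q.2 a))
        (hF.comp measurable_snd) hH]
    refine setLIntegral_congr_fun (hH hs) fun y _ => ?_
    exact SplitTree.treeProd_one_eq_prod _ _ _
  rw [← hemb.comap_map (η.map Prod.fst), hmap, ← hmap', hemb.comap_map]

end Density

/-! ### Bayes' formula -/

section Bayes

variable {Y T : Type*} [MeasurableSpace Y] [MeasurableSpace T]

/-- If the first component of the data has density `L (·, t)` given `t`, then its joint law with `t`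
has density `L`. -/
lemma map_compProd_eq_withDensity_prod {W : Type*} [MeasurableSpace W] {ρ : Measure Y} [SFinite ρ]
    {π : Measure T} [SFinite π] {K : Kernel T (Y × W)} [IsSFiniteKernel K] {L : Y × T → ℝ≥0∞}
    (hL : Measurable L) (hK : ∀ᵐ t ∂π, (K t).map Prod.fst = ρ.withDensity fun y => L (y, t)) :
    (π ⊗ₘ K).map (fun q => (q.2.1, q.1)) = (ρ.prod π).withDensity L := by
  refine Measure.ext_of_lintegral _ fun f hf => ?_
  have hsw : Measurable fun q : T × Y × W => (q.2.1, q.1) := by fun_prop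
  have hfsw : Measurable fun q : T × Y × W => f (q.2.1, q.1) := hf.comp hsw
  rw [lintegral_map hf hsw, Measure.lintegral_compProd hfsw,
    lintegral_withDensity_eq_lintegral_mul _ hL hf, lintegral_prod_symm' _ (hL.mul hf)]
  refine lintegral_congr_ae ?_
  filter_upwards [hK] with t ht
  have hft : Measurable fun y => f (y, t) := hf.comp measurable_prodMk_right
  have hLt : Measurable fun y => L (y, t) := hL.comp measurable_prodMk_right
  rw [← lintegral_map hft measurable_fst, ht, lintegral_withDensity_eq_lintegral_mul _ hLt hft]
  rfl

lemma fst_withDensity_prod {ρ : Measure Y} [SFinite ρ] {π : Measure T} [SFinite π]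
    {L : Y × T → ℝ≥0∞} (hL : Measurable L) :
    ((ρ.prod π).withDensity L).fst = ρ.withDensity fun y => ∫⁻ t, L (y, t) ∂π := by
  ext s hs
  rw [Measure.fst_apply hs, withDensity_apply _ (measurable_fst hs), withDensity_apply _ hs,
    show Prod.fst ⁻¹' s = s ×ˢ (univ : Set T) by ext; simp, setLIntegral_prod _ hL.aemeasurable]
  simp

lemma ae_evidence_lt_top {ρ : Measure Y} [SFinite ρ] {π : Measure T} [SFinite π]
    {L : Y × T → ℝ≥0∞} (hL : Measurable L) [IsFiniteMeasure ((ρ.prod π).withDensity L)] :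
    ∀ᵐ y ∂ρ, ∫⁻ t, L (y, t) ∂π < ∞ := by
  refine ae_lt_top hL.lintegral_prod_right' ?_
  rw [← lintegral_prod _ hL.aemeasurable, ← setLIntegral_univ, ← withDensity_apply _ .univ]
  exact measure_ne_top _ _

/-- Almost every observation has positive and finite evidence. -/
lemma ae_evidence_pos_lt_top {ρ : Measure Y} [SFinite ρ] {π : Measure T} [SFinite π]
    {L : Y × T → ℝ≥0∞} (hL : Measurable L) [IsFiniteMeasure ((ρ.prod π).withDensity L)] :
    ∀ᵐ y ∂((ρ.prod π).withDensity L).fst, 0 < ∫⁻ t, L (y, t) ∂π ∧ ∫⁻ t, L (y, t) ∂π < ∞ := by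
  rw [fst_withDensity_prod hL, ae_withDensity_iff hL.lintegral_prod_right']
  filter_upwards [ae_evidence_lt_top (π := π) hL] with y hy h0
  exact ⟨pos_iff_ne_zero.2 h0, hy⟩

/-- Bayes' formula: if `π` is the prior and `L (·, t)` is the density of the data given `t`, then
the normalised measures `L (y, ·) π` form a posterior. -/
lemma exists_isCondKernel_withDensity {ρ : Measure Y} [SFinite ρ] {π : Measure T}
    [IsProbabilityMeasure π] {L : Y × T → ℝ≥0∞} (hL : Measurable L)
    [IsFiniteMeasure ((ρ.prod π).withDensity L)] :
    ∃ post : Kernel Y T, IsMarkovKernel post ∧ ((ρ.prod π).withDensity L).IsCondKernel post ∧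
      ∀ y, ∫⁻ t, L (y, t) ∂π ≠ 0 → ∫⁻ t, L (y, t) ∂π ≠ ∞ →
        post y = (∫⁻ t, L (y, t) ∂π)⁻¹ • π.withDensity fun t => L (y, t) := by
  classical
  let ev : Y → ℝ≥0∞ := fun y => ∫⁻ t, L (y, t) ∂π
  have hev : Measurable ev := hL.lintegral_prod_right'
  have hLy : ∀ y, Measurable fun t => L (y, t) := fun y => hL.comp measurable_prodMk_left
  let good : Set Y := {y | ev y ≠ 0 ∧ ev y ≠ ∞}
  have hgood : MeasurableSet good :=
    (hev (measurableSet_singleton 0)).compl.inter (hev (measurableSet_singleton ∞)).compl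
  let dens : Y → T → ℝ≥0∞ := fun y t => (ev y)⁻¹ * L (y, t)
  have hdens : Measurable (Function.uncurry dens) := ((hev.comp measurable_fst).inv).mul hL
  let post : Kernel Y T :=
    Kernel.piecewise hgood ((Kernel.const Y π).withDensity dens) (Kernel.const Y π)
  have hpost : ∀ y, ev y ≠ 0 → ev y ≠ ∞ →
      post y = (ev y)⁻¹ • π.withDensity fun t => L (y, t) := fun y h0 ht => by
    rw [Kernel.piecewise_apply, if_pos ⟨h0, ht⟩, Kernel.withDensity_apply _ hdens,
      Kernel.const_apply]
    exact withDensity_smul _ (hLy y)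
  have hMarkov : IsMarkovKernel post := ⟨fun y => by
    by_cases hy : y ∈ good
    · rw [hpost y hy.1 hy.2]
      constructor
      rw [Measure.smul_apply, withDensity_apply _ .univ, setLIntegral_univ, smul_eq_mul]
      exact ENNReal.inv_mul_cancel hy.1 hy.2
    · rw [Kernel.piecewise_apply, if_neg hy, Kernel.const_apply]; infer_instance⟩
  refine ⟨post, hMarkov, ⟨?_⟩, hpost⟩
  rw [fst_withDensity_prod hL]
  have hfin : ∫⁻ y, ev y ∂ρ ≠ ∞ := by
    rw [← lintegral_prod _ hL.aemeasurable, ← setLIntegral_univ, ← withDensity_apply _ .univ]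
    exact measure_ne_top _ _
  have : IsFiniteMeasure (ρ.withDensity ev) := isFiniteMeasure_withDensity hfin
  refine Measure.ext_of_lintegral _ fun f hf => ?_
  rw [Measure.lintegral_compProd hf, lintegral_withDensity_eq_lintegral_mul _ hev
      hf.lintegral_kernel_prod_right', lintegral_withDensity_eq_lintegral_mul _ hL hf,
    lintegral_prod _ (hL.mul hf).aemeasurable]
  refine lintegral_congr_ae ?_
  filter_upwards [ae_evidence_lt_top (π := π) hL] with y hy
  simp only [Pi.mul_apply]
  have hfy : Measurable fun t => f (y, t) := hf.comp measurable_prodMk_left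
  by_cases h0 : ev y = 0
  · have hz : ∀ᵐ t ∂π, L (y, t) = 0 := (lintegral_eq_zero_iff (hLy y)).1 h0
    rw [h0, zero_mul]
    refine (lintegral_congr_ae (g := fun _ => 0) ?_).trans lintegral_zero |>.symm
    filter_upwards [hz] with t ht
    rw [ht, zero_mul]
  · rw [hpost y h0 hy.ne, lintegral_smul_measure,
      lintegral_withDensity_eq_lintegral_mul _ (hLy y) hfy, smul_eq_mul, ← mul_assoc,
      ENNReal.mul_inv_cancel h0 hy.ne, one_mul]
    rfl

end Bayes

section Posterior

variable {D n : ℕ} {x : Fin n → Fin D → ℝ} {m : Fin n → ℝ} {Z : Type*} [MeasurableSpace Z]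
  {ν : Measure Z} {p : Node D → ℝ → Z → ℝ≥0∞}

lemma measurable_treeProd_marginalLik [SigmaFinite ν]
    (hp : Measurable fun q : Node D × ℝ × Z => p q.1 q.2.1 q.2.2) :
    Measurable fun q : (Fin n → ℝ) × SplitTree D =>
      SplitTree.treeProd (fun _ => 1) (marginalLik x m ν p q.1) Node.root q.2 :=
  SplitTree.measurable_treeProd_of_node measurable_const (measurable_marginalLik hp) Node.root

/-- The joint law of data and tree has the tree-wise product of the marginal likelihood
contributions as density with respect to the product of the reference measure and the prior. -/
lemma jointLaw_eq_withDensity [SigmaFinite ν] (hx01 : ∀ i d, x i d ∈ Set.Icc (0 : ℝ) 1)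
    (hm : ∀ i, 0 < m i) (hn : 1 ≤ n) (Q : RUHWT x)
    (hp : Measurable fun q : Node D × ℝ × Z => p q.1 q.2.1 q.2.2)
    (hp1 : ∀ A, ∫⁻ w, ∫⁻ z, p A w z ∂ν = 1) (γ : Measure ℝ) [IsProbabilityMeasure γ]
    (K : Kernel (SplitTree D) ((Fin n → ℝ) × (List Bool → Z))) [IsMarkovKernel K]
    (hK : ∀ᵐ t ∂Q.law, IsCoefficientModel x m ν p γ t (K t)) :
    jointLaw Q.law K = ((refMeasure x m γ).prod Q.law).withDensity fun q =>
      SplitTree.treeProd (fun _ => 1) (marginalLik x m ν p q.1) Node.root q.2 := by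
  have hroot : ((Node.root : Node D).pts x).Nonempty := by
    rw [Node.pts_root hx01]; exact ⟨⟨0, hn⟩, Finset.mem_univ _⟩
  refine map_compProd_eq_withDensity_prod (measurable_treeProd_marginalLik hp) ?_
  filter_upwards [hK, Q.ae_isFull hroot] with t ht hfull
  exact ht.map_fst_eq hx01 hm hn hp hp1 hfull

end Posterior


/-! ### The posterior of the tree -/

theorem theorem2p1 {D n : ℕ} (hn : 1 ≤ n)
    -- unique training locations in the unit cube, and a base measure `∑ i, m i • δ_{x i}`
    (x : Fin n → Fin D → ℝ) (hx : Function.Injective x) (hx01 : ∀ i d, x i d ∈ Set.Icc (0 : ℝ) 1)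
    (m : Fin n → ℝ) (hm : ∀ i, 0 < m i)
    -- the prior of the tree
    (Q : RUHWT x)
    -- the coefficient densities `p_A(w, z | φ)`, with latent variables in `Z`, at a fixed `φ`
    {Z : Type*} [MeasurableSpace Z] (ν : Measure Z) [SigmaFinite ν]
    {Θ : Type*} (p : Θ → Node D → ℝ → Z → ℝ≥0∞) (φ : Θ)
    (hp : Measurable fun q : Node D × ℝ × Z => p φ q.1 q.2.1 q.2.2)
    (hp1 : ∀ A, ∫⁻ w, ∫⁻ z, p φ A w z ∂ν = 1)
    -- the law of the scaling coefficient
    (γ : Measure ℝ) [IsProbabilityMeasure γ]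
    -- the conditional law of `(y, z)` given the tree
    (K : Kernel (SplitTree D) ((Fin n → ℝ) × (List Bool → Z))) [IsMarkovKernel K]
    (hK : ∀ᵐ t ∂Q.law, IsCoefficientModel x m ν (p φ) γ t (K t)) :
    -- the recursion determines `Φ` on all nodes that contain a training location
    (∀ y : Fin n → ℝ, (∃ Φ, Q.IsPhi (marginalLik x m ν (p φ) y) Φ) ∧
      ∀ Φ Φ', Q.IsPhi (marginalLik x m ν (p φ) y) Φ → Q.IsPhi (marginalLik x m ν (p φ) y) Φ' →
        ∀ A : Node D, (A.pts x).Nonempty → Φ A = Φ' A) ∧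
    -- the posterior of the tree given `y` exists
    (∃ post : Kernel (Fin n → ℝ) (SplitTree D), IsMarkovKernel post ∧
      (jointLaw Q.law K).IsCondKernel post) ∧
    -- and it is a RUHWT with the reweighted parameters
    (∀ post : Kernel (Fin n → ℝ) (SplitTree D), IsMarkovKernel post →
      (jointLaw Q.law K).IsCondKernel post →
      ∀ᵐ y ∂(jointLaw Q.law K).fst, ∀ Φ, Q.IsPhi (marginalLik x m ν (p φ) y) Φ →
        0 < Φ Node.root ∧ Φ Node.root < ∞ ∧
        ∃ Q' : RUHWT x, Q.IsReweighting (marginalLik x m ν (p φ) y) Φ Q' ∧ post y = Q'.law) := by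
  have hn' : ((Node.root : Node D).pts x).Nonempty := by
    rw [Node.pts_root hx01]; exact ⟨⟨0, hn⟩, Finset.mem_univ _⟩
  have hM := measurable_marginalLik (x := x) (m := m) (ν := ν) hp
  have hMy : ∀ y d, Measurable fun q : Node D × I => marginalLik x m ν (p φ) y q.1 d q.2 :=
    fun y d => (hM d).comp measurable_prodMk_left
  have hL := measurable_treeProd_marginalLik (x := x) (m := m) (ν := ν) hp
  have hjoint := jointLaw_eq_withDensity hx01 hm hn Q hp hp1 γ K hK
  have hjprob : IsFiniteMeasure (jointLaw Q.law K) := by unfold jointLaw; infer_instance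
  have hfin := hjprob
  rw [hjoint] at hfin
  obtain ⟨post₀, hpost₀, hcond₀, hform⟩ := exists_isCondKernel_withDensity hL
    (ρ := refMeasure x m γ) (π := Q.law)
  rw [← hjoint] at hcond₀
  refine ⟨fun y => ⟨⟨_, Q.isPhi_meanProd (hMy y)⟩, fun Φ Φ' hΦ hΦ' A hA => ?_⟩,
    ⟨post₀, hpost₀, hcond₀⟩, fun post hpost hcond => ?_⟩
  · rw [RUHWT.IsPhi.eq_meanProd Q (hMy y) hΦ hA, RUHWT.IsPhi.eq_meanProd Q (hMy y) hΦ' hA]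
  have hae : post =ᵐ[(jointLaw Q.law K).fst] post₀ :=
    Kernel.ae_eq_of_compProd_eq (hcond.disintegrate.trans hcond₀.disintegrate.symm)
  have hev := ae_evidence_pos_lt_top hL (ρ := refMeasure x m γ) (π := Q.law)
  rw [← hjoint] at hev
  filter_upwards [hae, hev] with y hy ⟨hpos, hlt⟩ Φ hΦ
  have hΦeq : ∀ A : Node D, (A.pts x).Nonempty →
      Q.meanProd (marginalLik x m ν (p φ) y) A = Φ A := fun A hA =>
    (RUHWT.IsPhi.eq_meanProd Q (hMy y) hΦ hA).symm
  have hroot : ∫⁻ t, SplitTree.treeProd (fun _ => 1) (marginalLik x m ν (p φ) y) Node.root t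
      ∂Q.law = Φ Node.root := hΦeq _ hn'
  have hmeas : Measurable (Q.meanProd (marginalLik x m ν (p φ) y)) :=
    (Q.measurable_meanProd hM).comp measurable_prodMk_left
  obtain ⟨Q', hQ'⟩ := Q.exists_isReweighting (hMy y) hmeas
  refine ⟨hroot ▸ hpos, hroot ▸ hlt, Q', hQ'.congr hΦeq, ?_⟩
  rw [hy, hform y hpos.ne' hlt.ne]
  exact (hQ'.treeLaw_eq (hMy y) hmeas (Q.isPhi_meanProd (hMy y)) n hn'
    (Node.card_pts_root_le.trans n.le_succ) hpos.ne' hlt.ne).symm
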